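/- Let $q\ge 2$ and $d_v,d_c\ge 1$ be integers, and represent $\mathbb Z/q\mathbb Z$ by $\{0,\dots,q-1\}$. The Lee weight of $a\in\mathbb Z/q\mathbb Z$ is $\min(a,q-a)$. The Lee type of a vector over $\mathbb Z/q\mathbb Z$ is the tuple $(\omega(0),\dots,\omega(\lfloor q/2\rfloor))$, where $\omega(i)$ is the fraction of its entries of Lee weight $i$. For $n\ge1$ with $d_c\mid nd_v$ put $m=nd_v/d_c$. Choose $\mathbf c\in(\mathbb Z/q\mathbb Z)^n$, $\mathbf u\in((\mathbb Z/q\mathbb Z)^\times)^{nd_v}$ and a permutation $\Pi$ of the $nd_v$ positions independently and uniformly at random. Let $\mathbf z=\Pi(\mathbf z'\odot\mathbf u)$, where $\mathbf z'$ repeats every entry of $\mathbf c$ exactly $d_v$ times. Split $\mathbf z$ into $m$ blocks of length $d_c$, one for each check node of the $(d_v,d_c)$-regular LDPC code; $\mathbf z$ satisfies the check equations if each block sums to $0$ modulo $q$. Let $$a^{(n)}(\bm\omega)=\Pr\big(\mathbf z\text{ satisfies the check equations}\,\big|\,\mathbf z\text{ has Lee type }\bm\omega\big).$$ Let $g(\mathbf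 t)=\sum_w g_w\,t_1^{w_1}\cdots t_{\lfloor q/2\rfloor}^{w_{\lfloor q/2\rfloor}}$, where $w=(w_0,\dots,w_{\lfloor q/2\rfloor})$ runs over the tuples of nonnegative integers with sum $d_c$, and $g_w$ is the number of vectors in $(\mathbb Z/q\mathbb Z)^{d_c}$ with zero sum and exactly $w_i$ entries of Lee weight $i$ for every $i$. When $nd_v\bm\omega$ is integral and $d_c\mid nd_v$, put $$b^{(n)}(\bm\omega)=\mathrm{coeff}\big(g(\mathbf t)^m,\mathbf t^{nd_v\bm\omega}\big)\Big/\binom{nd_v}{nd_v\,\omega(0),\dots,nd_v\,\omega(\lfloor q/2\rfloor)},\qquad \mathbf t^{nd_v\bm\omega}=\prod_{i=1}^{\lfloor q/2\rfloor}t_i^{nd_v\omega(i)} .$$ Let $H(\bm\omega)=-\sum_{i=0}^{\lfloor q/2\rfloor}\omega(i)\log_2\omega(i)$, and let $\widehat{\bm\omega}=1-\omega(0)$ if $q$ is odd and $\widehat{\bm\omega}=1-\omega(0)-\omega(q/2)$ if $q$ is even. Let $\bm\omega\in(0,1)^{\lfloor q/2\rfloor+1}$ with $\sum_i\omega(i)=1$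 be such that $nd_v\,\omega(i)\in\mathbb N$ for all $i$, for some $n\ge1$. Suppose that $\mathbf t^\star=(t^\star_1,\dots,t^\star_{\lfloor q/2\rfloor})$ is a positive real solution of the saddle-point equations $$t_i\,\frac{\partial g(\mathbf t)^{1/d_c}}{\partial t_i}=\omega(i)\,g(\mathbf t)^{1/d_c},\qquad i=1,\dots,\lfloor q/2\rfloor .$$ Then: 1. $\mathbf t^\star$ is the unique positive real solution. 2. There are infinitely many $n$ with $d_c\mid nd_v$, $nd_v\bm\omega$ integral and $b^{(n)}(\bm\omega)\neq0$, and, as $n\to\infty$ along these $n$, $$\frac1n\log_2 b^{(n)}(\bm\omega)\longrightarrow d_v\Big(-H(\bm\omega)+\log_2 \big(g(\mathbf t^\star)^{1/d_c}\big)-\sum_{i=1}^{\lfloor q/2\rfloor}\omega(i)\log_2 t_i^\star\Big).$$ 3. There are infinitely many $n$ for which $a^{(n)}(\bm\omega)$ is defined and nonzero, and, as $n\to\infty$ along these $n$, $$\frac1n\log_2 a^{(n)}(\bm\omega)\longrightarrow d_v\Big(-H(\bm\omega)-\widehat{\bm\omega}+\log_2 \big(g(\mathbf t^\star)^{1/d_c}\big)-\sum_{i=1}^{\lfloor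 q/2\rfloor}\omega(i)\log_2 t_i^\star\Big).$$ -/

import Mathlib

open Filter Topology

namespace LeeLDPC

/-- The Lee weight `min (a, q - a)` of `a ∈ ℤ/qℤ = {0, …, q-1}`. -/
def leeWeight (q : ℕ) (a : ZMod q) : ℕ := min a.val (q - a.val)

/-- The Lee weight decomposition `(w_0, …, w_{⌊q/2⌋})` of a vector over `ℤ/qℤ` (indexed by an
arbitrary finite set): `w_i` is the number of entries of Lee weight `i`. -/
def leeCount (q : ℕ) {ι : Type*} [Fintype ι] (z : ι → ZMod q) (i : Fin (q / 2 + 1)) : ℕ :=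
  (Finset.univ.filter fun k => leeWeight q (z k) = (i : ℕ)).card

/-- The Lee type of a vector: the relative frequencies of the Lee weights of its entries. -/
noncomputable def leeType (q : ℕ) {ι : Type*} [Fintype ι] (z : ι → ZMod q)
    (i : Fin (q / 2 + 1)) : ℝ :=
  (leeCount q z i : ℝ) / (Fintype.card ι : ℝ)

/-- An outcome of the random experiment that defines a random `(dv, dc)`-regular LDPC code of
length `n` with `m` check nodes together with a random word: the word `c`, the labels (units of
`ℤ/qℤ`) of the `n * dv` edges at the variable nodes, and the bijection of these edges with the
`m * dc` edges at the check nodes. There is none unless `n * dv = m * dc`. -/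
abbrev Outcome (q n m dv dc : ℕ) : Type :=
  (Fin n → ZMod q) × (Fin n × Fin dv → (ZMod q)ˣ) × (Fin n × Fin dv ≃ Fin m × Fin dc)

/-- The vector `z = Π (z' ⊙ u)`, where `z'` repeats each entry of `c` exactly `dv` times. The
entry `z (j, k)` is the one on the `k`-th edge of the `j`-th check node. -/
def edgeVector {q n m dv dc : ℕ} (x : Outcome q n m dv dc) : Fin m × Fin dc → ZMod q :=
  fun e => x.1 (x.2.2.symm e).1 * (x.2.1 (x.2.2.symm e) : ZMod q)

/-- The check equations: the entries at each check node sum up to zero. -/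
def SatisfiesChecks {q m dc : ℕ} (z : Fin m × Fin dc → ZMod q) : Prop :=
  ∀ j, ∑ k, z (j, k) = 0

/-- `a⁽ⁿ⁾(ω)`: the conditional probability that `z` satisfies the check equations given that the
Lee type of `z` is `ω`, all outcomes being equally likely; there are `m = n dv / dc` check nodes.
It is `0` by convention where the conditioning event is empty. -/
noncomputable def checkProb (q dv dc : ℕ) (ω : Fin (q / 2 + 1) → ℝ) (n : ℕ) : ℝ :=
  (Nat.card {x : Outcome q n (n * dv / dc) dv dc //
      leeType q (edgeVector x) = ω ∧ SatisfiesChecks (edgeVector x)} : ℝ) /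
    (Nat.card {x : Outcome q n (n * dv / dc) dv dc // leeType q (edgeVector x) = ω} : ℝ)

/-- The number of `z ∈ (ℤ/qℤ)^dc` with zero sum and Lee weight decomposition `w`. -/
noncomputable def checkCount (q dc : ℕ) (w : Fin (q / 2 + 1) → ℕ) : ℕ :=
  Nat.card {z : Fin dc → ZMod q // ∑ k, z k = 0 ∧ leeCount q z = w}

/-- The generating function `g(t) = ∑_w g_w t_1^{w_1} ⋯ t_{⌊q/2⌋}^{w_{⌊q/2⌋}}` of one check node,
`w` ranging over the compositions of `dc`. The index `i : Fin (q / 2)` stands for the Lee weight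
`i + 1`. -/
noncomputable def genFun (q dc : ℕ) : MvPolynomial (Fin (q / 2)) ℝ :=
  ∑ w ∈ Finset.piAntidiag (Finset.univ : Finset (Fin (q / 2 + 1))) dc,
    MvPolynomial.C (checkCount q dc w : ℝ) *
      ∏ i : Fin (q / 2), (MvPolynomial.X i : MvPolynomial (Fin (q / 2)) ℝ) ^ w i.succ

/-- The function `t ↦ g(t)^{1/dc}`. -/
noncomputable def genFunRoot (q dc : ℕ) (t : Fin (q / 2) → ℝ) : ℝ :=
  (MvPolynomial.eval t (genFun q dc)) ^ (1 / (dc : ℝ))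

/-- `t` is a positive solution of `t_i ∂(g^{1/dc})/∂t_i = ω(i) g^{1/dc}`, `i = 1, …, ⌊q/2⌋`. -/
def IsSaddlePoint (q dc : ℕ) (ω : Fin (q / 2 + 1) → ℝ) (t : Fin (q / 2) → ℝ) : Prop :=
  (∀ i, 0 < t i) ∧
    ∀ i, t i * deriv (fun s => genFunRoot q dc (Function.update t i s)) (t i) =
      ω i.succ * genFunRoot q dc t

/-- The entropy in bits. -/
noncomputable def entropy {ι : Type*} [Fintype ι] (p : ι → ℝ) : ℝ :=
  -∑ i, p i * Real.logb 2 (p i)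

/-- The fraction `ω̂` of entries whose Lee weight is attained by two elements of `ℤ/qℤ`. -/
noncomputable def twoFraction (q : ℕ) (ω : Fin (q / 2 + 1) → ℝ) : ℝ :=
  if Odd q then 1 - ω 0 else 1 - ω 0 - ω (Fin.last (q / 2))

/-- `n` is a length at which `m = n dv / dc` and all `n dv ω(i)` are nonnegative integers. -/
def IsLength (q dv dc : ℕ) (ω : Fin (q / 2 + 1) → ℝ) (n : ℕ) : Prop :=
  dc ∣ n * dv ∧ ∀ i, ∃ k : ℕ, ω i * n * dv = k

/-- The quotient `coeff(g^m, t^{n dv ω}) / binom(n dv, n dv ω)` with `m = n dv / dc`. It is used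
only for `n` with `IsLength q dv dc ω n`, where no rounding occurs. -/
noncomputable def coeffQuotient (q dv dc : ℕ) (ω : Fin (q / 2 + 1) → ℝ) (n : ℕ) : ℝ :=
  MvPolynomial.coeff
      (Finsupp.equivFunOnFinite.symm fun i : Fin (q / 2) => ⌊ω i.succ * n * dv⌋₊)
      (genFun q dc ^ (n * dv / dc)) /
    (Nat.multinomial Finset.univ fun i : Fin (q / 2 + 1) => ⌊ω i * n * dv⌋₊ : ℝ)

end LeeLDPC

/-!
The edge vector `z` is invariant in law under permutations of its positions and, as the labels are
random units, under changes of sign at every position. Vectors with the same Lee type differ by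
such a signed permutation (`exists_signed_perm`), so `z` is uniform given its Lee type. Hence
`checkProb` is `coeffQuotient` divided by `2 ^ (n dv ω̂)` wherever the type is attained
(`checkProb_eq`), and the third claim follows from the second.

The polynomial `g = genFun` is the sum of the monomials `t ^ cnt z` over the words `z` satisfying
one check, which include a word with monomial `1` and, for `dc ≥ 2`, words with monomials
`t_i ^ 2`. The saddle-point equations say that the Gibbs distribution `p_z = t ^ cnt z / g(t)` has
mean `dc ω` (`IsSaddlePoint.isGibbsMean`). The mean determines the Gibbs distribution by strict
convexity of `log g` in the variables `log t_i`, here in the form of the symmetrised relative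
entropy, and the monomials `1` and `t_i ^ 2` recover `t` from it (`IsGibbsMean.eq`).

For the growth rate of the coefficient of `t ^ (m dc ω)` in `g ^ m`, the upper bound is
`coeff · t ^ (m dc ω) ≤ g(t) ^ m`. For the lower bound the Gibbs distribution is approximated by
integral counts with the exact mean, rounding errors being absorbed by the monomials `1` and
`t_i ^ 2` (`IsGibbsMean.exists_counts`); the corresponding multinomial coefficient bounds the
coefficient from below and grows at the rate of the entropy of the Gibbs distribution, which is the
upper bound again. This settles the multiples `m` of a fixed number. Supermultiplicativity of the
coefficients extends it to all `m` at which the coefficient does not vanish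
(`IsGibbsMean.tendsto_log_scaledCoeff_div`).
-/

namespace LeeLDPC

/-! ### Asymptotics of multinomial coefficients -/

/-- Stirling's formula to the precision `log n! = n (log n - 1 + o(1))`. -/
theorem tendsto_log_factorial_div :
    Tendsto (fun n : ℕ => Real.log (n.factorial) / n - Real.log n + 1) atTop (𝓝 0) := by
  have h1 : Tendsto (fun n : ℕ => Real.log (Stirling.stirlingSeq n) / (n : ℝ)) atTop (𝓝 0) :=
    (Stirling.tendsto_stirlingSeq_sqrt_pi.log (by positivity)).div_atTop
      tendsto_natCast_atTop_atTop
  have h2 : Tendsto (fun n : ℕ => Real.log (n : ℝ) / (n : ℝ)) atTop (𝓝 0) := by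
    have := (Real.isLittleO_log_id_atTop.tendsto_div_nhds_zero).comp
      (tendsto_natCast_atTop_atTop (R := ℝ))
    simpa [Function.comp_def] using this
  have h3 : Tendsto (fun n : ℕ => Real.log 2 / (n : ℝ)) atTop (𝓝 0) :=
    tendsto_const_nhds.div_atTop tendsto_natCast_atTop_atTop
  have h := (h1.add (h2.const_mul (1 / 2))).add (h3.const_mul (1 / 2))
  simp only [mul_zero, add_zero] at h
  refine h.congr' ?_
  filter_upwards [eventually_gt_atTop 0] with n hn
  have hn' : (0 : ℝ) < n := by exact_mod_cast hn
  rw [Stirling.log_stirlingSeq_formula, Real.log_mul two_ne_zero hn'.ne',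
    Real.log_div hn'.ne' (Real.exp_ne_zero 1), Real.log_exp]
  field_simp
  ring

/-- The exponential growth rate of a multinomial coefficient is the entropy of the limiting
frequencies. -/
theorem tendsto_log_multinomial_div {S ι : Type*} [Fintype S] {l : Filter ι}
    {k : ι → S → ℕ} {N : ι → ℕ} {p : S → ℝ} (hp : ∀ z, 0 < p z) (hN : Tendsto N l atTop)
    (hsum : ∀ᶠ i in l, ∑ z, k i z = N i)
    (hk : ∀ z, Tendsto (fun i => (k i z : ℝ) / N i) l (𝓝 (p z))) :
    Tendsto (fun i => Real.log (Nat.multinomial Finset.univ (k i)) / N i) l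
      (𝓝 (-∑ z, p z * Real.log (p z))) := by
  -- The error term of Stirling's formula, which also covers `n = 0` in the form `hfac`.
  set ψ : ℕ → ℝ := fun n => Real.log (n.factorial) / n - Real.log n + 1 with hψ
  have hfac : ∀ n : ℕ, Real.log (n.factorial) = n * (Real.log n - 1 + ψ n) := by
    intro n
    rcases Nat.eq_zero_or_pos n with rfl | hn
    · simp
    · have hn' : (n : ℝ) ≠ 0 := by positivity
      simp only [hψ]
      field_simp
      ring
  have hNr : Tendsto (fun i => (N i : ℝ)) l atTop := tendsto_natCast_atTop_atTop.comp hN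
  have hk_top : ∀ z, Tendsto (fun i => k i z) l atTop := by
    intro z
    rw [← tendsto_natCast_atTop_iff (R := ℝ)]
    refine ((hk z).pos_mul_atTop (hp z) hNr).congr' ?_
    filter_upwards [hN.eventually_gt_atTop 0] with i hi
    have : (N i : ℝ) ≠ 0 := by positivity
    field_simp
  have hlim : Tendsto (fun i => ψ (N i) - ∑ z, (k i z : ℝ) / N i *
      (Real.log ((k i z : ℝ) / N i) + ψ (k i z))) l
      (𝓝 (0 - ∑ z, p z * (Real.log (p z) + 0))) :=
    (tendsto_log_factorial_div.comp hN).sub <| tendsto_finsetSum _ fun z _ =>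
      (hk z).mul (((hk z).log (hp z).ne').add (tendsto_log_factorial_div.comp (hk_top z)))
  simp only [add_zero, zero_sub] at hlim
  refine hlim.congr' ?_
  filter_upwards [hN.eventually_gt_atTop 0, hsum,
    eventually_all.2 fun z => (hk_top z).eventually_gt_atTop 0] with i hi hs hz
  have hi' : (0 : ℝ) < N i := by exact_mod_cast hi
  have hlog : Real.log (Nat.multinomial Finset.univ (k i)) =
      Real.log ((N i).factorial) - ∑ z, Real.log ((k i z).factorial) := by
    have h := Nat.multinomial_spec Finset.univ (k i)
    rw [hs] at h
    rw [← h]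
    push_cast
    rw [Real.log_mul, Real.log_prod]
    · ring
    · intro z _
      positivity
    · exact Finset.prod_ne_zero_iff.2 fun z _ => by positivity
    · have := Nat.multinomial_pos Finset.univ (k i)
      positivity
  have hs' : ∑ z, (k i z : ℝ) = N i := by exact_mod_cast hs
  have hterm : ∀ z, (k i z : ℝ) / N i * (Real.log ((k i z : ℝ) / N i) + ψ (k i z)) =
      (Real.log ((k i z).factorial) - k i z * (Real.log (N i) - 1)) / N i := by
    intro z
    have hz' : (0 : ℝ) < k i z := by exact_mod_cast hz z
    rw [hfac (k i z), Real.log_div hz'.ne' hi'.ne']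
    ring
  rw [hlog, hfac (N i), Finset.sum_congr rfl fun z _ => hterm z, ← Finset.sum_div,
    Finset.sum_sub_distrib, ← Finset.sum_mul, hs']
  field_simp
  ring

/-! ### Coefficients of powers of a sum of monomials -/

section Monomials

variable {σ S : Type*} [Fintype S]

/-- The polynomial `∑_z X^{cnt z}` with one monomial for every `z : S`. -/
noncomputable def monomialSum (cnt : S → σ →₀ ℕ) : MvPolynomial σ ℝ :=
  ∑ z, MvPolynomial.monomial (cnt z) 1

theorem eval_monomialSum [Fintype σ] (cnt : S → σ →₀ ℕ) (t : σ → ℝ) :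
    MvPolynomial.eval t (monomialSum cnt) = ∑ z, ∏ a, t a ^ cnt z a := by
  simp only [monomialSum, map_sum, MvPolynomial.eval_monomial, one_mul]
  exact Finset.sum_congr rfl fun z _ => Finsupp.prod_fintype _ _ fun a => pow_zero _

theorem coeff_monomialSum_pow_nonneg (cnt : S → σ →₀ ℕ) (m : ℕ) (E : σ →₀ ℕ) :
    0 ≤ MvPolynomial.coeff E (monomialSum cnt ^ m) := by
  classical
  induction m generalizing E with
  | zero =>
    rw [pow_zero, MvPolynomial.coeff_one]
    split_ifs <;> norm_num
  | succ m ih =>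
    rw [pow_succ, MvPolynomial.coeff_mul]
    refine Finset.sum_nonneg fun x _ => mul_nonneg (ih _) ?_
    simp only [monomialSum, MvPolynomial.coeff_sum, MvPolynomial.coeff_monomial]
    exact Finset.sum_nonneg fun z _ => by split_ifs <;> norm_num

/-- The elementary upper bound `coeff (g ^ m, E) t ^ E ≤ g(t) ^ m` for `t > 0`. -/
theorem coeff_monomialSum_pow_mul_le [Fintype σ] (cnt : S → σ →₀ ℕ) (m : ℕ) (E : σ →₀ ℕ) {t : σ → ℝ}
    (ht : ∀ a, 0 < t a) :
    MvPolynomial.coeff E (monomialSum cnt ^ m) * ∏ a, t a ^ E a ≤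
      MvPolynomial.eval t (monomialSum cnt) ^ m := by
  rw [← map_pow, MvPolynomial.eval_eq']
  by_cases hE : E ∈ (monomialSum cnt ^ m).support
  · exact Finset.single_le_sum
      (f := fun d => MvPolynomial.coeff d (monomialSum cnt ^ m) * ∏ a, t a ^ d a)
      (fun d _ => mul_nonneg (coeff_monomialSum_pow_nonneg _ _ _)
        (Finset.prod_nonneg fun a _ => (pow_pos (ht a) _).le)) hE
  · rw [MvPolynomial.notMem_support_iff.1 hE, zero_mul]
    exact Finset.sum_nonneg fun d _ => mul_nonneg (coeff_monomialSum_pow_nonneg _ _ _)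
        (Finset.prod_nonneg fun a _ => (pow_pos (ht a) _).le)

theorem coeff_mul_coeff_le_coeff_monomialSum_pow_add (cnt : S → σ →₀ ℕ) (m m' : ℕ)
    (E E' : σ →₀ ℕ) :
    MvPolynomial.coeff E (monomialSum cnt ^ m) * MvPolynomial.coeff E' (monomialSum cnt ^ m') ≤
      MvPolynomial.coeff (E + E') (monomialSum cnt ^ (m + m')) := by
  classical
  rw [pow_add, MvPolynomial.coeff_mul]
  exact Finset.single_le_sum
    (f := fun x : (σ →₀ ℕ) × (σ →₀ ℕ) => MvPolynomial.coeff x.1 (monomialSum cnt ^ m) *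
      MvPolynomial.coeff x.2 (monomialSum cnt ^ m'))
    (fun x _ => mul_nonneg (coeff_monomialSum_pow_nonneg _ _ _)
      (coeff_monomialSum_pow_nonneg _ _ _)) (by simp :
      (E, E') ∈ Finset.HasAntidiagonal.antidiagonal (E + E'))

/-- Choosing the monomial `X ^ cnt z` from exactly `k z` of the `m` factors bounds a coefficient
from below by a multinomial coefficient. -/
theorem multinomial_le_coeff_monomialSum_pow (cnt : S → σ →₀ ℕ) (k : S → ℕ) {m : ℕ}
    (hk : ∑ z, k z = m) {E : σ →₀ ℕ} (hE : ∑ z, k z • cnt z = E) :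
    (Nat.multinomial Finset.univ k : ℝ) ≤ MvPolynomial.coeff E (monomialSum cnt ^ m) := by
  classical
  have hterm : ∀ k' : S → ℕ, MvPolynomial.coeff E ((Nat.multinomial Finset.univ k' :
      MvPolynomial σ ℝ) * ∏ z, MvPolynomial.monomial (cnt z) (1 : ℝ) ^ k' z) =
      if ∑ z, k' z • cnt z = E then (Nat.multinomial Finset.univ k' : ℝ) else 0 := by
    intro k'
    rw [← MvPolynomial.C_eq_coe_nat, MvPolynomial.coeff_C_mul]
    simp only [MvPolynomial.monomial_pow, one_pow]
    rw [← MvPolynomial.monomial_sum_one, MvPolynomial.coeff_monomial]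
    simp
  rw [monomialSum, Finset.sum_pow_eq_sum_piAntidiag, MvPolynomial.coeff_sum]
  simp only [hterm]
  have := Finset.single_le_sum
    (f := fun k' : S → ℕ => if ∑ z, k' z • cnt z = E then
      (Nat.multinomial Finset.univ k' : ℝ) else 0)
    (fun k' _ => by positivity)
    (by simpa using hk : k ∈ Finset.piAntidiag Finset.univ m)
  simpa [hE] using this

end Monomials

/-! ### The Gibbs distribution of a sum of monomials -/

section Gibbs

variable {σ S : Type*} [Fintype σ] [Fintype S]

/-- The Gibbs distribution on `S` with weights `t ^ cnt z`, normalised by `g(t) = ∑_z t ^ cnt z`. -/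
noncomputable def gibbs (cnt : S → σ →₀ ℕ) (t : σ → ℝ) (z : S) : ℝ :=
  (∏ a, t a ^ cnt z a) / MvPolynomial.eval t (monomialSum cnt)

variable {cnt : S → σ →₀ ℕ} {t : σ → ℝ}

theorem eval_monomialSum_pos [Nonempty S] (ht : ∀ a, 0 < t a) :
    0 < MvPolynomial.eval t (monomialSum cnt) := by
  rw [eval_monomialSum]
  exact Finset.sum_pos (fun z _ => Finset.prod_pos fun a _ => pow_pos (ht a) _)
    Finset.univ_nonempty

theorem gibbs_pos [Nonempty S] (ht : ∀ a, 0 < t a) (z : S) : 0 < gibbs cnt t z :=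
  div_pos (Finset.prod_pos fun a _ => pow_pos (ht a) _) (eval_monomialSum_pos ht)

theorem sum_gibbs [Nonempty S] (ht : ∀ a, 0 < t a) : ∑ z, gibbs cnt t z = 1 := by
  simp only [gibbs]
  rw [← Finset.sum_div, ← eval_monomialSum, div_self (eval_monomialSum_pos ht).ne']

theorem log_gibbs [Nonempty S] (ht : ∀ a, 0 < t a) (z : S) :
    Real.log (gibbs cnt t z) = ∑ a, cnt z a * Real.log (t a) -
      Real.log (MvPolynomial.eval t (monomialSum cnt)) := by
  rw [gibbs, Real.log_div (Finset.prod_pos fun a _ => pow_pos (ht a) _).ne'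
    (eval_monomialSum_pos ht).ne', Real.log_prod fun a _ => (pow_pos (ht a) _).ne']
  simp only [Real.log_pow]

/-- The vector `μ` is the mean of `cnt` under the Gibbs distribution with parameter `t`; this is
the saddle-point equation. -/
def IsGibbsMean (cnt : S → σ →₀ ℕ) (t : σ → ℝ) (μ : σ → ℝ) : Prop :=
  ∀ a, ∑ z, gibbs cnt t z * cnt z a = μ a

variable {μ : σ → ℝ}

theorem IsGibbsMean.sum_gibbs_mul (h : IsGibbsMean cnt t μ) (l : σ → ℝ) :
    ∑ z, gibbs cnt t z * ∑ a, cnt z a * l a = ∑ a, μ a * l a := by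
  simp only [Finset.mul_sum]
  rw [Finset.sum_comm]
  simp only [← mul_assoc, ← Finset.sum_mul, h _]

theorem IsGibbsMean.entropy_gibbs [Nonempty S] (h : IsGibbsMean cnt t μ) (ht : ∀ a, 0 < t a) :
    -∑ z, gibbs cnt t z * Real.log (gibbs cnt t z) =
      Real.log (MvPolynomial.eval t (monomialSum cnt)) - ∑ a, μ a * Real.log (t a) := by
  simp only [log_gibbs ht, mul_sub, Finset.sum_sub_distrib, ← Finset.sum_mul, sum_gibbs ht,
    h.sum_gibbs_mul]
  ring

theorem sub_mul_log_sub_log_nonneg {x y : ℝ} (hx : 0 < x) (hy : 0 < y) :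
    0 ≤ (x - y) * (Real.log x - Real.log y) := by
  rcases le_total x y with h | h
  · exact mul_nonneg_of_nonpos_of_nonpos (sub_nonpos.2 h)
      (sub_nonpos.2 (Real.log_le_log hx h))
  · exact mul_nonneg (sub_nonneg.2 h) (sub_nonneg.2 (Real.log_le_log hy h))

theorem eq_of_sub_mul_log_sub_log_eq_zero {x y : ℝ} (hx : 0 < x) (hy : 0 < y)
    (h : (x - y) * (Real.log x - Real.log y) = 0) : x = y := by
  rcases mul_eq_zero.1 h with h | h
  · linarith
  · exact Real.log_injOn_pos hx hy (by linarith)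

/-- The mean determines the Gibbs distribution: the symmetrised relative entropy
`∑_z (p_s z - p_t z) (log p_s z - log p_t z)` is a combination of differences of means. -/
theorem IsGibbsMean.gibbs_eq [Nonempty S] {s : σ → ℝ} (hs : IsGibbsMean cnt s μ)
    (ht : IsGibbsMean cnt t μ) (hs0 : ∀ a, 0 < s a) (ht0 : ∀ a, 0 < t a) (z : S) :
    gibbs cnt s z = gibbs cnt t z := by
  have key : ∑ z, (gibbs cnt s z - gibbs cnt t z) *
      (Real.log (gibbs cnt s z) - Real.log (gibbs cnt t z)) = 0 := by
    have hdiff : ∀ z, Real.log (gibbs cnt s z) - Real.log (gibbs cnt t z) =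
        ∑ a, cnt z a * (Real.log (s a) - Real.log (t a)) -
          (Real.log (MvPolynomial.eval s (monomialSum cnt)) -
            Real.log (MvPolynomial.eval t (monomialSum cnt))) := by
      intro z
      simp only [log_gibbs hs0, log_gibbs ht0, mul_sub, Finset.sum_sub_distrib]
      ring
    simp only [hdiff, mul_sub (gibbs _ _ _ - gibbs _ _ _), sub_mul (gibbs _ _ _),
      Finset.sum_sub_distrib, ← Finset.sum_mul, sum_gibbs hs0, sum_gibbs ht0, hs.sum_gibbs_mul,
      ht.sum_gibbs_mul]
    ring
  have hz := (Finset.sum_eq_zero_iff_of_nonneg fun z _ =>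
    sub_mul_log_sub_log_nonneg (gibbs_pos hs0 z) (gibbs_pos ht0 z)).1 key z (Finset.mem_univ z)
  exact eq_of_sub_mul_log_sub_log_eq_zero (gibbs_pos hs0 z) (gibbs_pos ht0 z) hz

variable {o : S} {e : σ → S}

/-- The monomials `1` and `t_a ^ 2` alone recover `t` from its Gibbs distribution. -/
theorem IsGibbsMean.eq {s : σ → ℝ} (hs : IsGibbsMean cnt s μ)
    (ht : IsGibbsMean cnt t μ) (hs0 : ∀ a, 0 < s a) (ht0 : ∀ a, 0 < t a)
    (ho : cnt o = 0) (he : ∀ a, cnt (e a) = Finsupp.single a 2) : s = t := by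
  classical
  have : Nonempty S := ⟨o⟩
  have hg := hs.gibbs_eq ht hs0 ht0
  have hG : MvPolynomial.eval s (monomialSum cnt) = MvPolynomial.eval t (monomialSum cnt) := by
    have := hg o
    simp only [gibbs, ho, Finsupp.coe_zero, Pi.zero_apply, pow_zero, Finset.prod_const_one,
      one_div, inv_inj] at this
    exact this
  funext a
  have h := hg (e a)
  have hmon : ∀ u : σ → ℝ, ∏ b, u b ^ (Finsupp.single a 2 : σ →₀ ℕ) b = u a ^ 2 := by
    intro u
    rw [Finset.prod_eq_single a] <;> simp +contextual [eq_comm]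
  rw [gibbs, gibbs, hG, div_left_inj' (eval_monomialSum_pos ht0).ne', he, hmon, hmon] at h
  exact (pow_left_inj₀ (hs0 a).le (ht0 a).le two_ne_zero).1 h

end Gibbs

/-! ### Growth rate of the coefficients -/

section Growth

variable {σ S : Type*} [Fintype σ] [Fintype S] {cnt : S → σ →₀ ℕ} {t μ : σ → ℝ} {o : S} {e : σ → S}

/-- The exponent `m μ`; it is only meaningful when `m μ` is integral. -/
noncomputable def scaledExponent (μ : σ → ℝ) (m : ℕ) : σ →₀ ℕ :=
  Finsupp.equivFunOnFinite.symm fun a => ⌊μ a * m⌋₊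

/-- An integral approximation of the Gibbs distribution with the exact mean: round `D j p_z` down
and double it, put the deficit of the mean, which is bounded, on the elements `e a`, and the
remaining mass on `o`. Doubling makes the deficit even, as needed for the monomials `t_a ^ 2`. -/
theorem IsGibbsMean.exists_counts (h : IsGibbsMean cnt t μ) (ht : ∀ a, 0 < t a)
    (ho : cnt o = 0) (he : ∀ a, cnt (e a) = Finsupp.single a 2) {D : ℕ} (hD : 0 < D) {d : σ → ℕ}
    (hd : ∀ a, μ a * D = d a) :
    ∃ k : ℕ → S → ℕ, (∀ᶠ j in atTop, ∑ z, k j z = 2 * D * j) ∧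
      (∀ j a, ∑ z, k j z * cnt z a = d a * (2 * j)) ∧
      ∀ z, Tendsto (fun j => (k j z : ℝ) / (2 * D * j : ℕ)) atTop (𝓝 (gibbs cnt t z)) := by
  classical
  have : Nonempty S := ⟨o⟩
  have hDr : (0 : ℝ) < D := by exact_mod_cast hD
  set p := gibbs cnt t with hp
  have hppos : ∀ z, 0 < p z := gibbs_pos ht
  set f : ℕ → S → ℕ := fun j z => ⌊p z * (D * j : ℕ)⌋₊ with hf
  have hfle : ∀ j a, ∑ z, f j z * cnt z a ≤ d a * j := by
    intro j a
    have : (∑ z, f j z * cnt z a : ℝ) ≤ d a * j := by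
      rw [← hd a, ← h a]
      simp only [Finset.sum_mul]
      refine Finset.sum_le_sum fun z _ => ?_
      calc (f j z : ℝ) * cnt z a ≤ (p z * (D * j : ℕ)) * cnt z a := by
            gcongr
            exact Nat.floor_le (by have := hppos z; positivity)
        _ = p z * cnt z a * D * j := by push_cast; ring
    exact_mod_cast this
  set y : ℕ → σ → ℕ := fun j a => d a * j - ∑ z, f j z * cnt z a with hy
  set k0 : ℕ → S → ℕ := fun j z => 2 * f j z + ∑ a, if z = e a then y j a else 0 with hk0
  set k : ℕ → S → ℕ := fun j z =>
    if z = o then 2 * D * j - ∑ z' ∈ Finset.univ.erase o, k0 j z' else k0 j z with hk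
  have hDj : Tendsto (fun j : ℕ => ((D * j : ℕ) : ℝ)) atTop atTop :=
    tendsto_natCast_atTop_atTop.comp (tendsto_id.const_mul_atTop' hD)
  have hflim : ∀ z, Tendsto (fun j => (f j z : ℝ) / (D * j : ℕ)) atTop (𝓝 (p z)) := fun z =>
    (tendsto_nat_floor_mul_div_atTop (hppos z).le).comp hDj
  have hylim : ∀ a, Tendsto (fun j => (y j a : ℝ) / (D * j : ℕ)) atTop (𝓝 0) := by
    intro a
    have hl : Tendsto (fun j => μ a - ∑ z, (f j z : ℝ) / (D * j : ℕ) * cnt z a) atTop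
        (𝓝 (μ a - ∑ z, p z * cnt z a)) :=
      tendsto_const_nhds.sub (tendsto_finsetSum _ fun z _ => (hflim z).mul_const _)
    rw [h a, sub_self] at hl
    refine hl.congr' ?_
    filter_upwards [eventually_gt_atTop 0] with j hj
    have hj' : (0 : ℝ) < j := by exact_mod_cast hj
    simp only [hy]
    rw [Nat.cast_sub (hfle j a)]
    push_cast
    rw [← hd a, sub_div, Finset.sum_div]
    congr 1
    · field_simp
    · exact Finset.sum_congr rfl fun z _ => by ring
  have hk0lim : ∀ z, Tendsto (fun j => (k0 j z : ℝ) / (2 * D * j : ℕ)) atTop (𝓝 (p z)) := by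
    intro z
    have hl : Tendsto (fun j => (f j z : ℝ) / (D * j : ℕ) +
        ∑ a, if z = e a then (y j a : ℝ) / (D * j : ℕ) / 2 else 0) atTop
        (𝓝 (p z + ∑ a : σ, 0)) := by
      refine (hflim z).add (tendsto_finsetSum _ fun a _ => ?_)
      split_ifs
      · simpa using (hylim a).div_const 2
      · exact tendsto_const_nhds
    rw [Finset.sum_const_zero, add_zero] at hl
    refine hl.congr fun j => ?_
    simp only [hk0]
    push_cast
    rw [add_div, Finset.sum_div]
    congr 1
    · rw [mul_assoc, mul_div_mul_left _ _ two_ne_zero]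
    · refine Finset.sum_congr rfl fun a _ => ?_
      split_ifs
      · rw [div_div]
        congr 1
        ring
      · simp
  have hsumlim : Tendsto (fun j => ∑ z ∈ Finset.univ.erase o, (k0 j z : ℝ) / (2 * D * j : ℕ)) atTop
      (𝓝 (1 - p o)) := by
    have : 1 - p o = ∑ z ∈ Finset.univ.erase o, p z := by
      rw [← sum_gibbs (cnt := cnt) ht, ← Finset.sum_erase_add _ _ (Finset.mem_univ o)]
      ring
    rw [this]
    exact tendsto_finsetSum _ fun z _ => hk0lim z
  have hle : ∀ᶠ j in atTop, ∑ z ∈ Finset.univ.erase o, k0 j z ≤ 2 * D * j := by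
    filter_upwards [hsumlim.eventually_lt_const (by linarith [hppos o] : 1 - p o < 1),
      eventually_gt_atTop 0] with j hj hj0
    rw [← Finset.sum_div, div_lt_one (by positivity)] at hj
    exact_mod_cast hj.le
  have hkne : ∀ j, ∀ z ∈ Finset.univ.erase o, k j z = k0 j z := fun j z hz =>
    if_neg (Finset.ne_of_mem_erase hz)
  refine ⟨k, ?_, ?_, ?_⟩
  · filter_upwards [hle] with j hj
    rw [← Finset.sum_erase_add _ _ (Finset.mem_univ o), Finset.sum_congr rfl (hkne j)]
    simp only [hk, if_true]
    exact Nat.add_sub_cancel' hj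
  · intro j a
    have h1 : ∑ z, k j z * cnt z a = ∑ z, k0 j z * cnt z a := by
      refine Finset.sum_congr rfl fun z _ => ?_
      by_cases hz : z = o
      · simp [hz, ho]
      · simp [hk, hz]
    have h2 : ∑ z, (∑ b, if z = e b then y j b else 0) * cnt z a = 2 * y j a := by
      simp only [Finset.sum_mul]
      rw [Finset.sum_comm]
      simp only [ite_mul, zero_mul, Finset.sum_ite_eq', Finset.mem_univ,
        if_true, he, Finsupp.single_apply, mul_ite, mul_zero]
      ring
    rw [h1]
    simp only [hk0, add_mul, Finset.sum_add_distrib]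
    rw [h2]
    have := hfle j a
    simp only [mul_assoc, ← Finset.mul_sum]
    rw [← mul_add]
    simp only [hy]
    rw [Nat.add_sub_cancel' this]
    ring
  · intro z
    by_cases hz : z = o
    · subst hz
      have hl := tendsto_const_nhds (x := (1 : ℝ)).sub hsumlim
      rw [sub_sub_cancel] at hl
      refine hl.congr' ?_
      filter_upwards [hle, eventually_gt_atTop 0] with j hj hj0
      simp only [hk, if_true]
      rw [Nat.cast_sub hj, sub_div, div_self (by positivity), ← Finset.sum_div]
      push_cast
      rfl
    · simpa only [hk, hz, if_false] using hk0lim z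

/-- Along multiples of `2 D` the coefficients are bounded from below by multinomial coefficients
whose growth rate is the entropy of the Gibbs distribution. -/
theorem IsGibbsMean.exists_lower_bound (h : IsGibbsMean cnt t μ) (ht : ∀ a, 0 < t a)
    (ho : cnt o = 0) (he : ∀ a, cnt (e a) = Finsupp.single a 2) {D : ℕ} (hD : 0 < D)
    (hd : ∀ a, ∃ k : ℕ, μ a * D = k) :
    ∃ b : ℕ → ℝ, (∀ j, 0 < b j) ∧
      (∀ᶠ j in atTop, b j ≤ MvPolynomial.coeff (scaledExponent μ (2 * D * j))
        (monomialSum cnt ^ (2 * D * j))) ∧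
      Tendsto (fun j => Real.log (b j) / (2 * D * j : ℕ)) atTop
        (𝓝 (Real.log (MvPolynomial.eval t (monomialSum cnt)) - ∑ a, μ a * Real.log (t a))) := by
  have : Nonempty S := ⟨o⟩
  choose d hd using hd
  obtain ⟨k, hsum, hmean, hlim⟩ := h.exists_counts ht ho he hD hd
  refine ⟨fun j => Nat.multinomial Finset.univ (k j), fun j => ?_, ?_, ?_⟩
  · exact Nat.cast_pos.2 (Nat.multinomial_pos _ _)
  · filter_upwards [hsum] with j hj
    refine multinomial_le_coeff_monomialSum_pow cnt (k j) hj ?_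
    ext a
    have hfloor : μ a * ((2 * D * j : ℕ) : ℝ) = (d a * (2 * j) : ℕ) := by
      push_cast
      rw [← hd a]
      ring
    simp only [scaledExponent, Finsupp.equivFunOnFinite_symm_apply_apply, hfloor, Nat.floor_natCast]
    rw [← hmean j a, Finsupp.finsetSum_apply]
    simp
  · rw [← h.entropy_gibbs ht]
    exact tendsto_log_multinomial_div (gibbs_pos ht)
      (tendsto_id.const_mul_atTop' (by positivity : 0 < 2 * D)) hsum hlim

/-- The coefficient of `t ^ (m μ)` in `g ^ m`. -/
noncomputable def scaledCoeff (cnt : S → σ →₀ ℕ) (μ : σ → ℝ) (m : ℕ) : ℝ :=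
  MvPolynomial.coeff (scaledExponent μ m) (monomialSum cnt ^ m)

/-- The `m` at which the coefficient of `t ^ (m μ)` in `g ^ m` is meaningful and nonzero. -/
def scaledSupport (cnt : S → σ →₀ ℕ) (μ : σ → ℝ) : Set ℕ :=
  {m | (∀ a, ∃ k : ℕ, μ a * m = k) ∧ scaledCoeff cnt μ m ≠ 0}

theorem scaledCoeff_pos {m : ℕ} (hm : m ∈ scaledSupport cnt μ) : 0 < scaledCoeff cnt μ m :=
  lt_of_le_of_ne (coeff_monomialSum_pow_nonneg _ _ _) hm.2.symm

theorem cast_scaledExponent {m : ℕ} {a : σ} (hm : ∃ k : ℕ, μ a * m = k) :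
    ((scaledExponent μ m a : ℕ) : ℝ) = μ a * m := by
  obtain ⟨k, hk⟩ := hm
  simp [scaledExponent, hk]

theorem log_scaledCoeff_div_le [Nonempty S] (ht : ∀ a, 0 < t a) {m : ℕ}
    (hm : m ∈ scaledSupport cnt μ) (hm0 : 0 < m) :
    Real.log (scaledCoeff cnt μ m) / m ≤
      Real.log (MvPolynomial.eval t (monomialSum cnt)) - ∑ a, μ a * Real.log (t a) := by
  have hle := Real.log_le_log
    (mul_pos (scaledCoeff_pos hm) (Finset.prod_pos fun a _ => pow_pos (ht a) _))
    (coeff_monomialSum_pow_mul_le cnt m (scaledExponent μ m) ht)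
  rw [Real.log_mul (scaledCoeff_pos hm).ne' (Finset.prod_pos fun a _ => pow_pos (ht a) _).ne',
    Real.log_prod fun a _ => (pow_pos (ht a) _).ne', Real.log_pow] at hle
  simp only [Real.log_pow, cast_scaledExponent (hm.1 _)] at hle
  have hm' : (0 : ℝ) < m := by exact_mod_cast hm0
  rw [div_le_iff₀ hm', sub_mul, Finset.sum_mul]
  have : ∀ a, μ a * Real.log (t a) * m = μ a * m * Real.log (t a) := fun a => by ring
  simp only [this]
  linarith

theorem scaledCoeff_mul_le {m m' : ℕ} (hm : ∀ a, ∃ k : ℕ, μ a * m = k)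
    (hm' : ∀ a, ∃ k : ℕ, μ a * m' = k) :
    scaledCoeff cnt μ m * scaledCoeff cnt μ m' ≤ scaledCoeff cnt μ (m + m') := by
  have hE : scaledExponent μ (m + m') = scaledExponent μ m + scaledExponent μ m' := by
    ext a
    obtain ⟨k, hk⟩ := hm a
    obtain ⟨k', hk'⟩ := hm' a
    have : μ a * ((m + m' : ℕ) : ℝ) = (k + k' : ℕ) := by
      push_cast
      rw [mul_add, hk, hk']
    simp only [Finsupp.add_apply, scaledExponent, Finsupp.equivFunOnFinite_symm_apply_apply, this,
      hk, hk', Nat.floor_natCast]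
  rw [scaledCoeff, scaledCoeff, scaledCoeff, hE]
  exact coeff_mul_coeff_le_coeff_monomialSum_pow_add cnt m m' _ _

theorem IsGibbsMean.eventually_scaledCoeff_ne_zero (h : IsGibbsMean cnt t μ) (ht : ∀ a, 0 < t a)
    (ho : cnt o = 0) (he : ∀ a, cnt (e a) = Finsupp.single a 2) {D : ℕ} (hD : 0 < D)
    (hd : ∀ a, ∃ k : ℕ, μ a * D = k) :
    ∀ᶠ j in atTop, scaledCoeff cnt μ (2 * D * j) ≠ 0 := by
  obtain ⟨b, hb, hle, -⟩ := h.exists_lower_bound ht ho he hD hd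
  filter_upwards [hle] with j hj
  exact ((hb j).trans_le hj).ne'

/-- The growth rate of the coefficients of `t ^ (m μ)` in `g ^ m`, along all `m` at which they do
not vanish. For the lower bound, split off from `m` the least element of the support in its residue
class modulo `2 D`: what is left is a multiple of `2 D`, and the coefficients are
supermultiplicative. -/
theorem IsGibbsMean.tendsto_log_scaledCoeff_div (h : IsGibbsMean cnt t μ) (ht : ∀ a, 0 < t a)
    (ho : cnt o = 0) (he : ∀ a, cnt (e a) = Finsupp.single a 2) {D : ℕ} (hD : 0 < D)
    (hd : ∀ a, ∃ k : ℕ, μ a * D = k) :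
    Tendsto (fun m : ℕ => Real.log (scaledCoeff cnt μ m) / m)
      (atTop ⊓ 𝓟 (scaledSupport cnt μ))
      (𝓝 (Real.log (MvPolynomial.eval t (monomialSum cnt)) - ∑ a, μ a * Real.log (t a))) := by
  have : Nonempty S := ⟨o⟩
  obtain ⟨b, hb, hle, hlim⟩ := h.exists_lower_bound ht ho he hD hd
  set M := scaledSupport cnt μ with hM
  set Λ := Real.log (MvPolynomial.eval t (monomialSum cnt)) - ∑ a, μ a * Real.log (t a)
  set P := 2 * D with hP
  have hP0 : 0 < P := by positivity
  -- `rep r` is the least element of the support congruent to `r` modulo `P`.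
  set rep : ℕ → ℕ := fun r => sInf {m | m ∈ M ∧ m % P = r} with hrep
  have hrep_mem : ∀ m ∈ M, rep (m % P) ∈ M ∧ rep (m % P) % P = m % P := fun m hm =>
    Nat.sInf_mem (s := {m' | m' ∈ M ∧ m' % P = m % P}) ⟨m, hm, rfl⟩
  have hrep_le : ∀ m ∈ M, rep (m % P) ≤ m := fun m hm => Nat.sInf_le ⟨hm, rfl⟩
  set j : ℕ → ℕ := fun m => (m - rep (m % P)) / P with hj
  have hdecomp : ∀ m ∈ M, m = rep (m % P) + P * j m := by
    intro m hm
    have hdvd : P ∣ m - rep (m % P) := (Nat.modEq_iff_dvd' (hrep_le m hm)).1 (hrep_mem m hm).2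
    have := Nat.mul_div_cancel' hdvd
    have := hrep_le m hm
    simp only [hj]
    omega
  -- The finitely many representatives and their coefficients are bounded by constants `K` and `B`,
  -- which do not contribute to the rate.
  set K : ℕ := ∑ r ∈ Finset.range P, rep r with hK
  have hrepK : ∀ m, rep (m % P) ≤ K := fun m =>
    Finset.single_le_sum (fun _ _ => Nat.zero_le _) (Finset.mem_range.2 (Nat.mod_lt m hP0))
  set B : ℝ := ∑ r ∈ Finset.range P, |Real.log (scaledCoeff cnt μ (rep r))| with hB
  have hrepB : ∀ m, -B ≤ Real.log (scaledCoeff cnt μ (rep (m % P))) := fun m =>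
    neg_le_of_abs_le <| Finset.single_le_sum
      (f := fun r => |Real.log (scaledCoeff cnt μ (rep r))|) (fun _ _ => abs_nonneg _)
      (Finset.mem_range.2 (Nat.mod_lt m hP0))
  have hl : atTop ⊓ 𝓟 M ≤ (atTop : Filter ℕ) := inf_le_left
  have hmem : ∀ᶠ m in atTop ⊓ 𝓟 M, m ∈ M := eventually_inf_principal.2 (Eventually.of_forall
    fun _ hm => hm)
  have hjtop : Tendsto j (atTop ⊓ 𝓟 M) atTop := by
    refine Tendsto.mono_left ?_ hl
    have h1 : Tendsto (fun m : ℕ => (m - K) / P) atTop atTop :=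
      (Nat.tendsto_div_const_atTop hP0.ne').comp (tendsto_sub_atTop_nat K)
    exact tendsto_atTop_mono (fun m => Nat.div_le_div_right (by have := hrepK m; omega)) h1
  have hinv : Tendsto (fun m : ℕ => ((m : ℝ))⁻¹) (atTop ⊓ 𝓟 M) (𝓝 0) :=
    tendsto_inv_atTop_nhds_zero_nat.mono_left hl
  have hpos : ∀ᶠ m : ℕ in atTop ⊓ 𝓟 M, 0 < m := hl (eventually_gt_atTop 0)
  have hratio : Tendsto (fun m : ℕ => ((P * j m : ℕ) : ℝ) / m) (atTop ⊓ 𝓟 M) (𝓝 1) := by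
    have h0 : Tendsto (fun m : ℕ => (rep (m % P) : ℝ) * (m : ℝ)⁻¹) (atTop ⊓ 𝓟 M) (𝓝 0) := by
      refine squeeze_zero (fun m => by positivity) (fun m => ?_)
        (by simpa using hinv.const_mul (K : ℝ))
      gcongr
      exact hrepK m
    have h1 := h0.const_sub 1
    rw [sub_zero] at h1
    refine h1.congr' ?_
    filter_upwards [hmem, hpos] with m hm hm0
    have hm0' : (0 : ℝ) < m := by exact_mod_cast hm0
    have : (m : ℝ) = rep (m % P) + (P * j m : ℕ) := by exact_mod_cast hdecomp m hm
    field_simp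
    linarith
  have hlow : Tendsto (fun m : ℕ => -B * (m : ℝ)⁻¹ +
      Real.log (b (j m)) / (P * j m : ℕ) * (((P * j m : ℕ) : ℝ) / m)) (atTop ⊓ 𝓟 M)
      (𝓝 (-B * 0 + Λ * 1)) :=
    (hinv.const_mul _).add ((hlim.comp hjtop).mul hratio)
  rw [mul_zero, zero_add, mul_one] at hlow
  refine tendsto_of_tendsto_of_tendsto_of_le_of_le' hlow tendsto_const_nhds ?_ ?_
  · filter_upwards [hmem, hpos, hjtop.eventually hle, hjtop.eventually_gt_atTop 0]
      with m hm hm0 hmb hj0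
    have hm0' : (0 : ℝ) < m := by exact_mod_cast hm0
    have hPj : ((P * j m : ℕ) : ℝ) ≠ 0 := by positivity
    have hint : ∀ a, ∃ k : ℕ, μ a * (P * j m : ℕ) = k := by
      intro a
      obtain ⟨k, hk⟩ := hd a
      refine ⟨2 * k * j m, ?_⟩
      push_cast [hP]
      rw [← hk]
      ring
    have hr := scaledCoeff_pos (hrep_mem m hm).1
    have hmul := scaledCoeff_mul_le (cnt := cnt) (hrep_mem m hm).1.1 hint
    rw [← hdecomp m hm] at hmul
    have hlog : Real.log (scaledCoeff cnt μ (rep (m % P))) + Real.log (b (j m)) ≤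
        Real.log (scaledCoeff cnt μ m) := by
      rw [← Real.log_mul hr.ne' (hb _).ne']
      exact Real.log_le_log (mul_pos hr (hb _)) ((mul_le_mul_of_nonneg_left hmb hr.le).trans hmul)
    rw [div_mul_div_cancel₀ hPj, ← div_eq_mul_inv, ← add_div]
    gcongr
    linarith [hrepB m]
  · filter_upwards [hmem, hpos] with m hm hm0
    exact log_scaledCoeff_div_le ht hm hm0

end Growth

/-! ### Lee weights -/

section Lee

variable {q : ℕ}

theorem leeCount_prod {κ ι : Type*} [Fintype κ] [Fintype ι] (Z : κ × ι → ZMod q)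
    (i : Fin (q / 2 + 1)) :
    leeCount q Z i = ∑ j, leeCount q (fun k => Z (j, k)) i := by
  simp only [leeCount, Finset.card_filter, Fintype.sum_prod_type]

variable [NeZero q]

theorem leeWeight_lt (a : ZMod q) : leeWeight q a < q / 2 + 1 := by
  have := a.val_lt
  simp only [leeWeight]
  omega

theorem leeWeight_eq_iff {a b : ZMod q} : leeWeight q a = leeWeight q b ↔ a = b ∨ a = -b := by
  have ha := a.val_lt
  have hb := b.val_lt
  rw [← (ZMod.val_injective q).eq_iff, ← (ZMod.val_injective q).eq_iff, ZMod.neg_val, leeWeight,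
    leeWeight]
  have hb0 : b = 0 ↔ b.val = 0 := (ZMod.val_eq_zero b).symm
  split_ifs with h
  · rw [hb0] at h
    omega
  · rw [hb0] at h
    omega

theorem leeWeight_natCast {i : ℕ} (hi : i < q / 2 + 1) : leeWeight q (i : ZMod q) = i := by
  have hq := NeZero.pos q
  rw [leeWeight, ZMod.val_natCast_of_lt (by omega)]
  omega

/-- The Lee weight of `a` as an index in `{0, …, ⌊q/2⌋}`. -/
def leeIndex (a : ZMod q) : Fin (q / 2 + 1) := ⟨leeWeight q a, leeWeight_lt a⟩

theorem leeIndex_eq_iff {a b : ZMod q} : leeIndex a = leeIndex b ↔ a = b ∨ a = -b := by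
  rw [leeIndex, leeIndex, Fin.mk.injEq, leeWeight_eq_iff]

theorem leeIndex_natCast (i : Fin (q / 2 + 1)) : leeIndex ((i : ℕ) : ZMod q) = i :=
  Fin.ext (leeWeight_natCast i.2)

variable {ι : Type*} [Fintype ι]

theorem leeCount_eq (z : ι → ZMod q) (i : Fin (q / 2 + 1)) :
    leeCount q z i = (Finset.univ.filter fun k => leeIndex (z k) = i).card := by
  simp only [leeCount, leeIndex, Fin.ext_iff]

theorem sum_leeCount (z : ι → ZMod q) : ∑ i, leeCount q z i = Fintype.card ι := by
  simp only [leeCount_eq]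
  exact (Finset.card_eq_sum_card_fiberwise fun _ _ => Finset.mem_univ _).symm

/-- The Lee weights `0` and (for even `q`) `q / 2` are attained once, all others twice. -/
theorem card_leeIndex_eq (i : Fin (q / 2 + 1)) :
    (Finset.univ.filter fun a : ZMod q => leeIndex a = i).card =
      if (i : ℕ) = 0 ∨ 2 * (i : ℕ) = q then 1 else 2 := by
  have hq := NeZero.pos q
  have hi := i.2
  have hset : (Finset.univ.filter fun a : ZMod q => leeIndex a = i) =
      {((i : ℕ) : ZMod q), -((i : ℕ) : ZMod q)} := by
    ext a
    rw [Finset.mem_filter, Finset.mem_insert, Finset.mem_singleton, ← leeIndex_eq_iff,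
      leeIndex_natCast]
    simp
  have hneg : ((i : ℕ) : ZMod q) = -((i : ℕ) : ZMod q) ↔ (i : ℕ) = 0 ∨ 2 * (i : ℕ) = q := by
    rw [eq_neg_iff_add_eq_zero, ← Nat.cast_add, ZMod.natCast_eq_zero_iff]
    constructor
    · rintro ⟨c, hc⟩
      rcases c with _ | _ | c
      · omega
      · omega
      · have : q * (c + 1 + 1) = q * c + 2 * q := by ring
        omega
    · rintro (h | h)
      · simp [h]
      · exact ⟨1, by omega⟩
  rw [hset]
  split_ifs with h
  · rw [← hneg.2 h, Finset.pair_eq_singleton, Finset.card_singleton]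
  · exact Finset.card_pair fun h' => h (hneg.1 h')

/-- The number of vectors with given Lee weight decomposition. -/
theorem card_leeCount_eq (w : Fin (q / 2 + 1) → ℕ) (hw : ∑ i, w i = Fintype.card ι) :
    Nat.card {z : ι → ZMod q // leeCount q z = w} = Nat.multinomial Finset.univ w *
      ∏ i, (Finset.univ.filter fun a : ZMod q => leeIndex a = i).card ^ w i := by
  classical
  set E : Fin (q / 2 + 1) →₀ ℕ := Finsupp.equivFunOnFinite.symm w with hE
  set p : MvPolynomial (Fin (q / 2 + 1)) ℕ := ∑ a : ZMod q, MvPolynomial.X (leeIndex a) with hp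
  have h1 : MvPolynomial.coeff E (p ^ Fintype.card ι) =
      Nat.card {z : ι → ZMod q // leeCount q z = w} := by
    have : p ^ Fintype.card ι =
        ∑ z : ι → ZMod q, MvPolynomial.monomial (∑ k, Finsupp.single (leeIndex (z k)) 1) 1 := by
      rw [← Finset.card_univ, ← Finset.prod_const, hp, Finset.prod_univ_sum]
      simp only [Fintype.piFinset_univ, MvPolynomial.monomial_sum_one]
      rfl
    rw [this, MvPolynomial.coeff_sum, Nat.card_eq_fintype_card, Fintype.card_subtype,
      Finset.card_filter]
    refine Finset.sum_congr rfl fun z _ => ?_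
    rw [MvPolynomial.coeff_monomial]
    refine if_congr ?_ rfl rfl
    rw [Finsupp.ext_iff, funext_iff]
    refine forall_congr' fun i => ?_
    rw [leeCount_eq, Finset.card_filter, Finsupp.finsetSum_apply]
    simp only [Finsupp.single_apply, hE, Finsupp.equivFunOnFinite_symm_apply_apply]
  have h2 : p = ∑ i, MvPolynomial.C (Finset.univ.filter fun a : ZMod q => leeIndex a = i).card *
      MvPolynomial.X i := by
    rw [hp, ← Finset.sum_fiberwise (s := Finset.univ) (g := leeIndex)]
    refine Finset.sum_congr rfl fun i _ => ?_
    rw [Finset.sum_congr rfl fun a ha => by rw [(Finset.mem_filter.1 ha).2], Finset.sum_const,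
      nsmul_eq_mul]
    simp
  rw [← h1, h2, Finset.sum_pow_eq_sum_piAntidiag, MvPolynomial.coeff_sum,
    Finset.sum_eq_single w]
  · simp only [mul_pow, Finset.prod_mul_distrib, ← map_pow, ← map_prod]
    rw [← MvPolynomial.C_eq_coe_nat, MvPolynomial.coeff_C_mul, MvPolynomial.coeff_C_mul]
    have : ∏ i, (MvPolynomial.X i : MvPolynomial (Fin (q / 2 + 1)) ℕ) ^ w i =
        MvPolynomial.monomial E 1 := by
      rw [MvPolynomial.monomial_eq, Finsupp.prod_fintype _ _ fun _ => pow_zero _]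
      simp [hE]
    rw [this, MvPolynomial.coeff_monomial, if_pos rfl, mul_one]
    simp
  · intro w' _ hw'
    simp only [mul_pow, Finset.prod_mul_distrib, ← map_pow, ← map_prod]
    rw [← MvPolynomial.C_eq_coe_nat, MvPolynomial.coeff_C_mul, MvPolynomial.coeff_C_mul]
    have : ∏ i, (MvPolynomial.X i : MvPolynomial (Fin (q / 2 + 1)) ℕ) ^ w' i =
        MvPolynomial.monomial (Finsupp.equivFunOnFinite.symm w') 1 := by
      rw [MvPolynomial.monomial_eq, Finsupp.prod_fintype _ _ fun _ => pow_zero _]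
      simp
    rw [this, MvPolynomial.coeff_monomial, if_neg, mul_zero, mul_zero]
    exact fun h => hw' (Finsupp.equivFunOnFinite.symm.injective h)
  · intro h
    simp [hw] at h

end Lee

/-! ### The generating function of a check node -/

section Check

variable {q dc : ℕ}

/-- The words satisfying one check equation of degree `dc`. -/
abbrev CheckWord (q dc : ℕ) : Type := {z : Fin dc → ZMod q // ∑ k, z k = 0}

/-- The exponent of the monomial that a word satisfying one check contributes to `genFun`. -/
noncomputable def checkExponent (q dc : ℕ) (z : CheckWord q dc) : Fin (q / 2) →₀ ℕ :=
  Finsupp.equivFunOnFinite.symm fun i => leeCount q z.1 i.succ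

theorem checkExponent_zero : checkExponent q dc ⟨0, by simp⟩ = 0 := by
  ext i
  simp [checkExponent, leeCount, leeWeight]

/-- A check node of degree one has the constant generating function `1`. -/
theorem checkExponent_eq_zero_of_degree_one (z : CheckWord q 1) : checkExponent q 1 z = 0 := by
  have : z = ⟨0, by simp⟩ := by
    ext k
    have := z.2
    rw [Fin.sum_univ_one] at this
    rw [Subsingleton.elim k 0, this]
    rfl
  rw [this, checkExponent_zero]

variable [NeZero q]

theorem genFun_eq_monomialSum : genFun q dc = monomialSum (checkExponent q dc) := by
  classical
  have hmaps : ∀ z ∈ (Finset.univ : Finset (CheckWord q dc)), leeCount q z.1 ∈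
      Finset.piAntidiag (Finset.univ : Finset (Fin (q / 2 + 1))) dc := fun z _ => by
    simp [sum_leeCount]
  rw [genFun, monomialSum, ← Finset.sum_fiberwise_of_maps_to hmaps]
  refine Finset.sum_congr rfl fun w _ => ?_
  have hmon : ∀ z ∈ Finset.univ.filter (fun z : CheckWord q dc => leeCount q z.1 = w),
      MvPolynomial.monomial (checkExponent q dc z) (1 : ℝ) =
        ∏ i : Fin (q / 2), (MvPolynomial.X i : MvPolynomial (Fin (q / 2)) ℝ) ^ w i.succ := by
    intro z hz
    rw [MvPolynomial.monomial_eq, Finsupp.prod_fintype _ _ fun _ => pow_zero _]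
    simp [checkExponent, (Finset.mem_filter.1 hz).2]
  rw [Finset.sum_congr rfl hmon, Finset.sum_const, nsmul_eq_mul]
  congr 1
  rw [checkCount, ← Fintype.card_subtype, ← Nat.card_eq_fintype_card,
    Nat.card_congr (Equiv.subtypeSubtypeEquivSubtypeInter _ (fun z => leeCount q z = w))]
  simp

/-- Words satisfying all the checks are families of words satisfying one check each. -/
def satisfiesChecksEquiv (q m dc : ℕ) :
    {Z : Fin m × Fin dc → ZMod q // SatisfiesChecks Z} ≃ (Fin m → CheckWord q dc) where
  toFun Z j := ⟨fun k => Z.1 (j, k), Z.2 j⟩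
  invFun f := ⟨fun e => (f e.1).1 e.2, fun j => (f j).2⟩
  left_inv _ := rfl
  right_inv _ := rfl

/-- Since the Lee weights of all entries add up to the length, the exponents of `t_1, …, t_{⌊q/2⌋}`
determine the whole decomposition. -/
theorem leeCount_eq_iff_succ {ι : Type*} [Fintype ι] {w : Fin (q / 2 + 1) → ℕ}
    (hw : ∑ i, w i = Fintype.card ι) (z : ι → ZMod q) :
    leeCount q z = w ↔ ∀ i : Fin (q / 2), leeCount q z i.succ = w i.succ := by
  refine ⟨fun h i => by rw [h], fun h => ?_⟩
  have h1 := sum_leeCount z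
  rw [Fin.sum_univ_succ, Finset.sum_congr rfl fun i _ => h i] at h1
  rw [Fin.sum_univ_succ] at hw
  funext i
  refine Fin.cases ?_ h i
  omega

theorem coeff_genFun_pow (m : ℕ) {w : Fin (q / 2 + 1) → ℕ} (hw : ∑ i, w i = m * dc) :
    MvPolynomial.coeff (Finsupp.equivFunOnFinite.symm fun i : Fin (q / 2) => w i.succ)
        (genFun q dc ^ m) =
      Nat.card {Z : Fin m × Fin dc → ZMod q // leeCount q Z = w ∧ SatisfiesChecks Z} := by
  classical
  have hcard : Nat.card {Z : Fin m × Fin dc → ZMod q // leeCount q Z = w ∧ SatisfiesChecks Z} =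
      Nat.card {f : Fin m → CheckWord q dc // ∀ i : Fin (q / 2),
        ∑ j, leeCount q (f j).1 i.succ = w i.succ} := by
    refine Nat.card_congr ?_
    refine (Equiv.subtypeEquivRight fun Z => and_comm).trans <|
      (Equiv.subtypeSubtypeEquivSubtypeInter SatisfiesChecks (fun Z => leeCount q Z = w)).symm.trans
        ((satisfiesChecksEquiv q m dc).subtypeEquiv fun Z => ?_)
    rw [leeCount_eq_iff_succ (by simpa using hw)]
    simp only [leeCount_prod]
    rfl
  rw [hcard, genFun_eq_monomialSum, monomialSum, Fintype.sum_pow, MvPolynomial.coeff_sum,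
    Nat.card_eq_fintype_card, Fintype.card_subtype, Finset.card_filter]
  push_cast
  refine Finset.sum_congr rfl fun f _ => ?_
  rw [← MvPolynomial.monomial_sum_one, MvPolynomial.coeff_monomial]
  refine if_congr ?_ rfl rfl
  rw [Finsupp.ext_iff]
  refine forall_congr' fun i => ?_
  rw [Finsupp.finsetSum_apply]
  simp [checkExponent]

/-- With two edges at the check node, the word `(i, -i, 0, …, 0)` contributes `t_i ^ 2`. -/
theorem exists_checkExponent_eq_single (hdc : 2 ≤ dc) (i : Fin (q / 2)) :
    ∃ z, checkExponent q dc z = Finsupp.single i 2 := by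
  classical
  obtain ⟨d, rfl⟩ := Nat.exists_eq_add_of_le' hdc
  set a : ZMod q := ((i.succ : ℕ) : ZMod q) with ha
  refine ⟨⟨Fin.cons a (Fin.cons (-a) 0), by simp [Fin.sum_univ_succ]⟩, ?_⟩
  have h1 : leeIndex a = i.succ := leeIndex_natCast i.succ
  have h2 : leeIndex (-a) = i.succ := by
    rw [← h1, leeIndex_eq_iff]
    exact Or.inr rfl
  have h0 : leeIndex (0 : ZMod q) = 0 := by
    simpa using leeIndex_natCast (q := q) 0
  ext b
  simp only [checkExponent, Finsupp.equivFunOnFinite_symm_apply_apply, leeCount_eq,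
    Finset.card_filter]
  rw [Fin.sum_univ_succ, Fin.sum_univ_succ]
  simp only [Fin.cons_zero, Fin.cons_succ, h1, h2, h0, Pi.zero_apply, Fin.succ_inj]
  have : (0 : Fin (q / 2 + 1)) ≠ b.succ := (Fin.succ_ne_zero b).symm
  simp only [this, Finsupp.single_apply, if_false, Finset.sum_const_zero]
  split_ifs <;> rfl

end Check

/-! ### The edge vector is uniform given its Lee type -/

section Uniform

variable {q n m dv dc : ℕ} {ω : Fin (q / 2 + 1) → ℝ}

/-- The Lee weight decomposition of the vectors of length `n dv` and Lee type `ω`. -/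
noncomputable def lengthCount (q dv : ℕ) (ω : Fin (q / 2 + 1) → ℝ) (n : ℕ)
    (i : Fin (q / 2 + 1)) : ℕ := ⌊ω i * n * dv⌋₊

theorem cast_lengthCount (hn : IsLength q dv dc ω n) (i : Fin (q / 2 + 1)) :
    (lengthCount q dv ω n i : ℝ) = ω i * n * dv := by
  obtain ⟨k, hk⟩ := hn.2 i
  rw [lengthCount, hk, Nat.floor_natCast]

theorem sum_lengthCount (hsum : ∑ i, ω i = 1) (hn : IsLength q dv dc ω n) :
    ∑ i, lengthCount q dv ω n i = n * dv := by
  have : (∑ i, lengthCount q dv ω n i : ℝ) = n * dv := by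
    simp only [cast_lengthCount hn, ← Finset.sum_mul, hsum, one_mul]
  exact_mod_cast this

theorem leeType_eq_iff (hdv : 0 < dv) (hn : IsLength q dv dc ω n) (hn0 : 0 < n)
    (z : Fin (n * dv / dc) × Fin dc → ZMod q) :
    leeType q z = ω ↔ leeCount q z = lengthCount q dv ω n := by
  have hcard : (Fintype.card (Fin (n * dv / dc) × Fin dc) : ℝ) = n * dv := by
    rw [Fintype.card_prod, Fintype.card_fin, Fintype.card_fin, Nat.div_mul_cancel hn.1]
    push_cast
    rfl
  rw [funext_iff, funext_iff]
  refine forall_congr' fun i => ?_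
  have hpos : (0 : ℝ) < n * dv := by positivity
  rw [leeType, hcard, div_eq_iff hpos.ne', ← Nat.cast_inj (R := ℝ), cast_lengthCount hn,
    mul_assoc]

/-- If an outcome of Lee type `ω` exists, then `n` is an admissible length. The case `n = 0` is
excluded because the empty vector has type `0` by the convention on division by zero. -/
theorem isLength_of_leeType_eq (hω : ∀ i, 0 < ω i)
    (x : Outcome q n (n * dv / dc) dv dc) (hx : leeType q (edgeVector x) = ω) :
    IsLength q dv dc ω n ∧ 0 < n := by
  have hcard : n * dv = n * dv / dc * dc := by
    simpa using Fintype.card_congr x.2.2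
  have htype : ∀ i, (leeCount q (edgeVector x) i : ℝ) / (n * dv : ℕ) = ω i := by
    intro i
    rw [← congrFun hx i, leeType, Fintype.card_prod, Fintype.card_fin, Fintype.card_fin]
    exact congrArg (fun N : ℕ => (leeCount q (edgeVector x) i : ℝ) / N) hcard
  have hn0 : 0 < n * dv := by
    rw [Nat.pos_iff_ne_zero]
    intro h0
    have h : (leeCount q (edgeVector x) 0 : ℝ) / (0 : ℕ) = ω 0 := by
      rw [← htype 0]
      exact congrArg (fun N : ℕ => (leeCount q (edgeVector x) 0 : ℝ) / N) h0.symm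
    rw [Nat.cast_zero, div_zero] at h
    exact (hω 0).ne h
  refine ⟨⟨Dvd.intro_left _ hcard.symm, fun i => ⟨leeCount q (edgeVector x) i, ?_⟩⟩,
    Nat.pos_of_mul_pos_right hn0⟩
  rw [← htype i]
  have hn' : 0 < n := Nat.pos_of_mul_pos_right hn0
  have hdv' : 0 < dv := Nat.pos_of_mul_pos_left hn0
  push_cast
  field_simp

variable [NeZero q]

/-- Two vectors with the same Lee weight decomposition differ by a signed permutation. -/
theorem exists_signed_perm {ι : Type*} [Fintype ι] {z z' : ι → ZMod q}
    (h : leeCount q z = leeCount q z') :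
    ∃ (π : Equiv.Perm ι) (ε : ι → (ZMod q)ˣ), ∀ k, z' k = ε k * z (π k) := by
  classical
  -- The fibres of the Lee weight have equal sizes; elements of equal weight agree up to sign.
  have hfib : ∀ i, Nonempty ({k // leeIndex (z' k) = i} ≃ {k // leeIndex (z k) = i}) := by
    intro i
    rw [← Fintype.card_eq, Fintype.card_subtype, Fintype.card_subtype, ← leeCount_eq,
      ← leeCount_eq, h]
  let π : Equiv.Perm ι := Equiv.ofFiberEquiv fun i => (hfib i).some
  have hπ : ∀ k, leeIndex (z (π k)) = leeIndex (z' k) := fun k =>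
    Equiv.ofFiberEquiv_map (fun i => (hfib i).some) k
  have hε : ∀ k, ∃ ε : (ZMod q)ˣ, z' k = ε * z (π k) := by
    intro k
    rcases leeIndex_eq_iff.1 (hπ k) with h | h
    · exact ⟨1, by simp [h]⟩
    · exact ⟨-1, by simp [h]⟩
  choose ε hε using hε
  exact ⟨π, ε, hε⟩

theorem card_edgeVector_eq_le {z z' : Fin m × Fin dc → ZMod q}
    (h : leeCount q z = leeCount q z') :
    Nat.card {x : Outcome q n m dv dc // edgeVector x = z} ≤
      Nat.card {x : Outcome q n m dv dc // edgeVector x = z'} := by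
  obtain ⟨π, ε, hε⟩ := exists_signed_perm h
  refine Nat.card_le_card_of_injective
    (fun x => ⟨(x.1.1, fun e => x.1.2.1 e * ε (π.symm (x.1.2.2 e)), x.1.2.2.trans π.symm), ?_⟩) ?_
  · funext k
    rw [hε k, ← congrFun x.2 (π k)]
    simp only [edgeVector, Equiv.symm_trans_apply, Equiv.symm_symm, Equiv.apply_symm_apply,
      Equiv.symm_apply_apply, Units.val_mul]
    ring
  · rintro ⟨⟨c, u, τ⟩, hx⟩ ⟨⟨c', u', τ'⟩, hx'⟩ hxx
    simp only [Subtype.mk.injEq, Prod.mk.injEq] at hxx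
    obtain ⟨rfl, hu, hτ⟩ := hxx
    have hτ' : τ = τ' := by
      ext1 e
      have := congrArg (fun f => f e) hτ
      exact π.symm.injective this
    subst hτ'
    have hu' : u = u' := by
      funext e
      exact mul_right_cancel (congrFun hu e)
    subst hu'
    rfl

theorem card_edgeVector_eq {z z' : Fin m × Fin dc → ZMod q}
    (h : leeCount q z = leeCount q z') :
    Nat.card {x : Outcome q n m dv dc // edgeVector x = z} =
      Nat.card {x : Outcome q n m dv dc // edgeVector x = z'} :=
  le_antisymm (card_edgeVector_eq_le h) (card_edgeVector_eq_le h.symm)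

/-- All vectors `z` with the decomposition `w` of `z₀` are hit equally often. -/
theorem card_outcome_eq (z₀ : Fin m × Fin dc → ZMod q) (P : (Fin m × Fin dc → ZMod q) → Prop) :
    Nat.card {x : Outcome q n m dv dc //
        leeCount q (edgeVector x) = leeCount q z₀ ∧ P (edgeVector x)} =
      Nat.card {z : Fin m × Fin dc → ZMod q // leeCount q z = leeCount q z₀ ∧ P z} *
        Nat.card {x : Outcome q n m dv dc // edgeVector x = z₀} := by
  classical
  rw [Nat.card_congr (Equiv.sigmaFiberEquiv (fun x : {x : Outcome q n m dv dc //
    leeCount q (edgeVector x) = leeCount q z₀ ∧ P (edgeVector x)} =>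
      (⟨edgeVector x.1, x.2⟩ : {z // leeCount q z = leeCount q z₀ ∧ P z}))).symm, Nat.card_sigma]
  have hfib : ∀ z : {z : Fin m × Fin dc → ZMod q // leeCount q z = leeCount q z₀ ∧ P z},
      Nat.card {x : {x : Outcome q n m dv dc //
        leeCount q (edgeVector x) = leeCount q z₀ ∧ P (edgeVector x)} //
          (⟨edgeVector x.1, x.2⟩ : {z // leeCount q z = leeCount q z₀ ∧ P z}) = z} =
      Nat.card {x : Outcome q n m dv dc // edgeVector x = z₀} := by
    rintro ⟨z, hz⟩
    rw [← card_edgeVector_eq hz.1]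
    refine Nat.card_congr ⟨fun x => ⟨x.1.1, congrArg Subtype.val x.2⟩,
      fun x => ⟨⟨x.1, by rw [x.2]; exact hz⟩, Subtype.ext x.2⟩, fun _ => rfl, fun _ => rfl⟩
  rw [Finset.sum_congr rfl fun z _ => hfib z, Finset.sum_const, smul_eq_mul, Finset.card_univ,
    ← Nat.card_eq_fintype_card]

/-- The number of sign choices for a vector of Lee type `ω` is `2 ^ (n dv ω̂)`. -/
theorem logb_prod_card_leeIndex (hq : 2 ≤ q) (hsum : ∑ i, ω i = 1) (hn : IsLength q dv dc ω n) :
    Real.logb 2 (∏ i, ((Finset.univ.filter fun a : ZMod q => leeIndex a = i).card : ℝ) ^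
      lengthCount q dv ω n i) = n * dv * twoFraction q ω := by
  have hlog : ∀ i : Fin (q / 2 + 1),
      Real.logb 2 ((Finset.univ.filter fun a : ZMod q => leeIndex a = i).card) =
        1 - (if i = 0 then 1 else 0) - (if 2 * (i : ℕ) = q then 1 else 0) := by
    intro i
    rw [card_leeIndex_eq]
    by_cases h0 : i = 0
    · subst h0
      simp [show (0 : ℕ) ≠ q by omega]
    · have h0' : (i : ℕ) ≠ 0 := fun h => h0 (Fin.ext h)
      by_cases h1 : 2 * (i : ℕ) = q
      · simp [h0, h1]
      · simp [h0, h1]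
  have hprod : ∀ i ∈ (Finset.univ : Finset (Fin (q / 2 + 1))),
      ((Finset.univ.filter fun a : ZMod q => leeIndex a = i).card : ℝ) ^
        lengthCount q dv ω n i ≠ 0 := by
    intro i _
    rw [card_leeIndex_eq]
    split_ifs <;> simp
  rw [Real.logb_prod _ _ hprod]
  simp only [Real.logb_pow, hlog, cast_lengthCount hn]
  have hlast : ∀ i : Fin (q / 2 + 1), (if 2 * (i : ℕ) = q then (1 : ℝ) else 0) =
      if Odd q then 0 else if i = Fin.last (q / 2) then 1 else 0 := by
    intro i
    have hi := i.2
    have hiff : 2 * (i : ℕ) = q ↔ ¬ Odd q ∧ i = Fin.last (q / 2) := by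
      rw [Fin.ext_iff, Fin.val_last, Nat.not_odd_iff]
      omega
    rw [if_congr hiff rfl rfl]
    by_cases h1 : Odd q <;> simp [h1]
  simp only [hlast, twoFraction]
  have e1 : ∀ i, ω i * n * dv * (1 - (if i = 0 then (1 : ℝ) else 0) -
      if Odd q then 0 else if i = Fin.last (q / 2) then 1 else 0) =
      n * dv * (ω i - (if i = 0 then ω i else 0) -
        if Odd q then 0 else if i = Fin.last (q / 2) then ω i else 0) := by
    intro i
    split_ifs <;> ring
  rw [Finset.sum_congr rfl fun i _ => e1 i, ← Finset.mul_sum, Finset.sum_sub_distrib,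
    Finset.sum_sub_distrib, hsum]
  split_ifs <;> simp

/-- Given that `z` can have Lee type `ω`, it is uniform on the vectors of this type, and so the
conditional probability is the coefficient of `g ^ m` divided by the number of these vectors. -/
theorem checkProb_eq (hdv : 0 < dv) (hsum : ∑ i, ω i = 1) (hn : IsLength q dv dc ω n)
    (hn0 : 0 < n) (x : Outcome q n (n * dv / dc) dv dc) (hx : leeType q (edgeVector x) = ω) :
    checkProb q dv dc ω n = coeffQuotient q dv dc ω n /
      ∏ i, ((Finset.univ.filter fun a : ZMod q => leeIndex a = i).card : ℝ) ^
        lengthCount q dv ω n i := by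
  have hcount := (leeType_eq_iff hdv hn hn0 _).1 hx
  have hw : ∑ i, lengthCount q dv ω n i = n * dv / dc * dc := by
    rw [sum_lengthCount hsum hn, Nat.div_mul_cancel hn.1]
  have hK : (Nat.card {x' : Outcome q n (n * dv / dc) dv dc // edgeVector x' = edgeVector x} : ℝ)
      ≠ 0 := by
    rw [Nat.cast_ne_zero]
    have : Nonempty {x' : Outcome q n (n * dv / dc) dv dc // edgeVector x' = edgeVector x} :=
      ⟨⟨x, rfl⟩⟩
    exact Nat.card_pos.ne'
  have hnum := card_outcome_eq (n := n) (dv := dv) (edgeVector x) SatisfiesChecks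
  have hden := card_outcome_eq (n := n) (dv := dv) (edgeVector x) fun _ => True
  simp only [and_true, hcount] at hnum hden
  rw [card_leeCount_eq _ (by simpa using hw)] at hden
  rw [checkProb]
  simp only [leeType_eq_iff hdv hn hn0]
  rw [hnum, hden]
  push_cast
  rw [mul_div_mul_right _ _ hK, ← coeff_genFun_pow _ hw, coeffQuotient, div_div]
  rfl

end Uniform

/-! ### Outcomes of a given Lee type -/

section Existence

variable {q n m dv dc : ℕ} {ω : Fin (q / 2 + 1) → ℝ}

theorem leeCount_edgeVector_one (c : Fin n → ZMod q) (τ : Fin n × Fin dv ≃ Fin m × Fin dc)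
    (i : Fin (q / 2 + 1)) :
    leeCount q (edgeVector (c, fun _ => 1, τ)) i = leeCount q c i * dv := by
  simp only [leeCount, edgeVector, Units.val_one, mul_one, Finset.card_filter]
  rw [Equiv.sum_comp τ.symm fun e => if leeWeight q (c e.1) = (i : ℕ) then 1 else 0,
    Fintype.sum_prod_type, Finset.sum_mul]
  refine Finset.sum_congr rfl fun a _ => ?_
  by_cases h : leeWeight q (c a) = (i : ℕ) <;> simp [h]

/-- When even `n ω` is integral, a word `c` of Lee type `ω` with unit labels gives an outcome of
this type. -/
theorem exists_outcome [NeZero q] (hdv : 0 < dv) (hsum : ∑ i, ω i = 1)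
    (hn : IsLength q dv dc ω n) (hn0 : 0 < n) (hint : ∀ i, ∃ k : ℕ, ω i * n = k) :
    ∃ x : Outcome q n (n * dv / dc) dv dc, leeType q (edgeVector x) = ω := by
  choose w hw using hint
  have hwsum : ∑ i, w i = Fintype.card (Fin n) := by
    have : (∑ i, w i : ℝ) = n := by
      simp only [← hw, ← Finset.sum_mul, hsum, one_mul]
    rw [Fintype.card_fin]
    exact_mod_cast this
  have hcard : 0 < Nat.card {c : Fin n → ZMod q // leeCount q c = w} := by
    rw [card_leeCount_eq w hwsum]
    refine Nat.mul_pos (Nat.multinomial_pos _ _) (Finset.prod_pos fun i _ => pow_pos ?_ _)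
    rw [card_leeIndex_eq]
    split_ifs <;> norm_num
  obtain ⟨⟨c, hc⟩⟩ := (Nat.card_pos_iff.1 hcard).1
  have τ : Fin n × Fin dv ≃ Fin (n * dv / dc) × Fin dc :=
    Fintype.equivOfCardEq (by simp [Nat.div_mul_cancel hn.1])
  refine ⟨(c, fun _ => 1, τ), (leeType_eq_iff hdv hn hn0 _).2 ?_⟩
  funext i
  rw [leeCount_edgeVector_one, hc, ← Nat.cast_inj (R := ℝ), cast_lengthCount hn, Nat.cast_mul, hw i]

end Existence

/-! ### The saddle-point equations -/

section Saddle

variable {q dc : ℕ} [NeZero q] {ω : Fin (q / 2 + 1) → ℝ} {t : Fin (q / 2) → ℝ}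

instance : Nonempty (CheckWord q dc) := ⟨⟨0, by simp⟩⟩

theorem genFun_eval_pos (ht : ∀ i, 0 < t i) : 0 < MvPolynomial.eval t (genFun q dc) := by
  rw [genFun_eq_monomialSum]
  exact eval_monomialSum_pos ht

theorem hasDerivAt_eval_genFun (ht : ∀ i, 0 < t i) (i : Fin (q / 2)) :
    HasDerivAt (fun s => MvPolynomial.eval (Function.update t i s) (genFun q dc))
      (∑ z, (checkExponent q dc z i : ℝ) * (∏ a, t a ^ checkExponent q dc z a) / t i) (t i) := by
  simp only [genFun_eq_monomialSum, eval_monomialSum]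
  refine HasDerivAt.fun_sum fun z _ => ?_
  set c := checkExponent q dc z
  have hsplit : ∀ s, ∏ a, Function.update t i s a ^ c a =
      s ^ c i * ∏ a ∈ Finset.univ.erase i, t a ^ c a := by
    intro s
    rw [← Finset.mul_prod_erase _ _ (Finset.mem_univ i), Function.update_self]
    congr 1
    exact Finset.prod_congr rfl fun a ha => by
      rw [Function.update_of_ne (Finset.ne_of_mem_erase ha)]
  simp only [hsplit]
  refine ((hasDerivAt_pow (c i) (t i)).mul_const
    (∏ a ∈ Finset.univ.erase i, t a ^ c a)).congr_deriv ?_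
  rw [← Finset.mul_prod_erase _ _ (Finset.mem_univ i)]
  have := (ht i).ne'
  rcases Nat.eq_zero_or_pos (c i) with h | h
  · simp [h]
  · obtain ⟨k, hk⟩ := Nat.exists_eq_add_of_le' h
    rw [hk, Nat.add_sub_cancel, pow_succ]
    field_simp

/-- The saddle-point equations say that the Gibbs distribution on the words satisfying one check
has mean Lee weight decomposition `dc ω`. -/
theorem IsSaddlePoint.isGibbsMean (hdc : 0 < dc) (h : IsSaddlePoint q dc ω t) :
    IsGibbsMean (checkExponent q dc) t fun i => dc * ω i.succ := by
  intro i
  have hpos := genFun_eval_pos (dc := dc) h.1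
  have hder := (hasDerivAt_eval_genFun (dc := dc) h.1 i).rpow_const (p := 1 / (dc : ℝ))
    (Or.inl (by rw [Function.update_eq_self]; exact hpos.ne'))
  have heq := h.2 i
  simp only [genFunRoot] at heq
  rw [hder.deriv, Function.update_eq_self, Real.rpow_sub_one hpos.ne', ← Finset.sum_div] at heq
  have hroot := Real.rpow_pos_of_pos hpos (1 / (dc : ℝ))
  have hti := h.1 i
  have hdc' : (0 : ℝ) < dc := by exact_mod_cast hdc
  simp only [gibbs, ← genFun_eq_monomialSum]
  have hsum : ∑ z, (∏ a, t a ^ checkExponent q dc z a) / MvPolynomial.eval t (genFun q dc) *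
      checkExponent q dc z i = (∑ z, (checkExponent q dc z i : ℝ) *
        ∏ a, t a ^ checkExponent q dc z a) / MvPolynomial.eval t (genFun q dc) := by
    rw [Finset.sum_div]
    exact Finset.sum_congr rfl fun z _ => by ring
  rw [hsum]
  set X := ∑ z, (checkExponent q dc z i : ℝ) * ∏ a, t a ^ checkExponent q dc z a
  set G := MvPolynomial.eval t (genFun q dc)
  set R := G ^ (1 / (dc : ℝ))
  have heq' : X / (dc * G) * R = ω i.succ * R := by
    rw [← heq]
    field_simp
  have := mul_right_cancel₀ hroot.ne' heq'
  rw [← this]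
  field_simp

/-- A saddle point excludes check nodes of degree one, whose generating function is constant. -/
theorem IsSaddlePoint.two_le (hq : 2 ≤ q) (hdc : 0 < dc) (hω : ∀ i, 0 < ω i)
    (h : IsSaddlePoint q dc ω t) : 2 ≤ dc := by
  by_contra hlt
  obtain rfl : dc = 1 := by omega
  have := h.isGibbsMean hdc ⟨0, by omega⟩
  simp only [checkExponent_eq_zero_of_degree_one, Finsupp.coe_zero, Pi.zero_apply, Nat.cast_zero,
    mul_zero, Finset.sum_const_zero, Nat.cast_one, one_mul] at this
  exact (hω _).ne this

end Saddle

/-! ### Growth rates along the admissible lengths -/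

section Lengths

variable {q dv dc n : ℕ} {ω : Fin (q / 2 + 1) → ℝ} {t : Fin (q / 2) → ℝ}

theorem IsLength.cast_div (hdc : 0 < dc) (hn : IsLength q dv dc ω n) :
    ((n * dv / dc : ℕ) : ℝ) = n * dv / dc := by
  rw [Nat.cast_div hn.1 (by positivity)]
  push_cast
  rfl

/-- Integrality of `n dv ω` gives integrality of the mean `dc ω` scaled by `n dv`. -/
theorem exists_nat_mean_mul (hint : ∀ i, ∃ k : ℕ, ω i * n * dv = k) (i : Fin (q / 2)) :
    ∃ k : ℕ, dc * ω i.succ * (n * dv : ℕ) = k := by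
  obtain ⟨k, hk⟩ := hint i.succ
  refine ⟨dc * k, ?_⟩
  push_cast
  rw [← hk]
  ring

variable [NeZero q]

theorem coeffQuotient_eq (hdc : 0 < dc) (hn : IsLength q dv dc ω n) :
    coeffQuotient q dv dc ω n =
      scaledCoeff (checkExponent q dc) (fun i => dc * ω i.succ) (n * dv / dc) /
        Nat.multinomial Finset.univ (lengthCount q dv ω n) := by
  have hE : (Finsupp.equivFunOnFinite.symm fun i : Fin (q / 2) => ⌊ω i.succ * n * dv⌋₊) =
      scaledExponent (fun i : Fin (q / 2) => dc * ω i.succ) (n * dv / dc) := by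
    have hdc' : (dc : ℝ) ≠ 0 := by positivity
    rw [scaledExponent, hn.cast_div hdc]
    congr 1
    funext i
    congr 1
    field_simp
  rw [coeffQuotient, hE, genFun_eq_monomialSum, scaledCoeff]
  rfl

/-- The set of `n` along which the growth rate of `coeffQuotient` is taken. -/
def coeffLengths (q dv dc : ℕ) (ω : Fin (q / 2 + 1) → ℝ) : Set ℕ :=
  {n | IsLength q dv dc ω n ∧ coeffQuotient q dv dc ω n ≠ 0}

theorem div_mem_scaledSupport (hdc : 0 < dc) (hn : n ∈ coeffLengths q dv dc ω) :
    n * dv / dc ∈ scaledSupport (checkExponent q dc) fun i => dc * ω i.succ := by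
  refine ⟨fun i => ?_, fun h0 => hn.2 ?_⟩
  · obtain ⟨k, hk⟩ := hn.1.2 i.succ
    refine ⟨k, ?_⟩
    have hdc' : (dc : ℝ) ≠ 0 := by positivity
    rw [← hk, hn.1.cast_div hdc]
    field_simp
  · rw [coeffQuotient_eq hdc hn.1, h0, zero_div]

theorem tendsto_logb_coeffQuotient (hq : 2 ≤ q) (hdv : 0 < dv) (hdc : 0 < dc)
    (hω : ∀ i, 0 < ω i) (hsum : ∑ i, ω i = 1)
    (hint : ∃ n : ℕ, 0 < n ∧ ∀ i, ∃ k : ℕ, ω i * n * dv = k)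
    (ht : IsSaddlePoint q dc ω t) :
    Tendsto (fun n : ℕ => 1 / (n : ℝ) * Real.logb 2 (coeffQuotient q dv dc ω n))
      (atTop ⊓ 𝓟 (coeffLengths q dv dc ω))
      (𝓝 (dv * (-entropy ω + Real.logb 2 (genFunRoot q dc t)
          - ∑ i : Fin (q / 2), ω i.succ * Real.logb 2 (t i)))) := by
  set A := coeffLengths q dv dc ω with hA
  have hdc' : (0 : ℝ) < dc := by exact_mod_cast hdc
  have hdv' : (0 : ℝ) < dv := by exact_mod_cast hdv
  have hl : atTop ⊓ 𝓟 A ≤ (atTop : Filter ℕ) := inf_le_left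
  have hmem : ∀ᶠ n in atTop ⊓ 𝓟 A, n ∈ A :=
    eventually_inf_principal.2 (Eventually.of_forall fun _ hn => hn)
  have hpos : ∀ᶠ n : ℕ in atTop ⊓ 𝓟 A, 0 < n := hl (eventually_gt_atTop 0)
  choose e he using exists_checkExponent_eq_single (q := q) (ht.two_le hq hdc hω)
  obtain ⟨n₀, hn₀, hint⟩ := hint
  have hcoeff := (ht.isGibbsMean hdc).tendsto_log_scaledCoeff_div ht.1
    (checkExponent_zero (q := q) (dc := dc)) he (Nat.mul_pos hn₀ hdv)
    (exists_nat_mean_mul hint)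
  have hm : Tendsto (fun n : ℕ => n * dv / dc) (atTop ⊓ 𝓟 A)
      (atTop ⊓ 𝓟 (scaledSupport (checkExponent q dc) fun i => dc * ω i.succ)) := by
    refine tendsto_inf.2 ⟨?_, tendsto_principal.2 ?_⟩
    · exact ((Nat.tendsto_div_const_atTop hdc.ne').comp
        (tendsto_id.atTop_mul_const' hdv)).mono_left hl
    · filter_upwards [hmem] with n hn
      exact div_mem_scaledSupport hdc hn
  have hmult := tendsto_log_multinomial_div (l := atTop ⊓ 𝓟 A) (k := lengthCount q dv ω)
    (N := fun n => n * dv) hω ((tendsto_id.atTop_mul_const' hdv).mono_left hl)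
    (by filter_upwards [hmem] with n hn using sum_lengthCount hsum hn.1) fun i => by
      refine tendsto_const_nhds.congr' ?_
      filter_upwards [hmem, hpos] with n hn hn0
      rw [cast_lengthCount hn.1]
      push_cast
      field_simp
  have h := ((hcoeff.comp hm).const_mul (dv / dc / Real.log 2 : ℝ)).sub
    (hmult.const_mul (dv / Real.log 2 : ℝ))
  have hlog2 : Real.log 2 ≠ 0 := (Real.log_pos one_lt_two).ne'
  convert h.congr' ?_ using 2
  · rw [genFunRoot, Real.logb_rpow_eq_mul_logb_of_pos (genFun_eval_pos ht.1), entropy,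
      genFun_eq_monomialSum]
    simp only [Real.logb, mul_assoc, ← Finset.mul_sum, ← mul_div_assoc, ← Finset.sum_div]
    field_simp
    ring
  · filter_upwards [hmem, hpos] with n hn hn0
    have hn0' : (0 : ℝ) < n := by exact_mod_cast hn0
    have hsc := scaledCoeff_pos (div_mem_scaledSupport hdc hn)
    have hM : (0 : ℝ) < Nat.multinomial Finset.univ (lengthCount q dv ω n) :=
      Nat.cast_pos.2 (Nat.multinomial_pos _ _)
    rw [coeffQuotient_eq hdc hn.1, Real.logb_div hsc.ne' hM.ne']
    simp only [Function.comp_def, hn.1.cast_div hdc, Real.logb]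
    push_cast
    field_simp

theorem logb_checkProb (hq : 2 ≤ q) (hdv : 0 < dv) (hω : ∀ i, 0 < ω i)
    (hsum : ∑ i, ω i = 1) (hn : checkProb q dv dc ω n ≠ 0) :
    n ∈ coeffLengths q dv dc ω ∧ Real.logb 2 (checkProb q dv dc ω n) =
      Real.logb 2 (coeffQuotient q dv dc ω n) - n * dv * twoFraction q ω := by
  have hne : Nonempty {x : Outcome q n (n * dv / dc) dv dc // leeType q (edgeVector x) = ω} := by
    by_contra hempty
    rw [not_nonempty_iff] at hempty
    refine hn ?_
    rw [checkProb, Nat.card_of_isEmpty (α := {x : Outcome q n (n * dv / dc) dv dc //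
      leeType q (edgeVector x) = ω}), Nat.cast_zero, div_zero]
  obtain ⟨x, hx⟩ := hne
  obtain ⟨hlen, hn0⟩ := isLength_of_leeType_eq hω x hx
  have heq := checkProb_eq hdv hsum hlen hn0 x hx
  have hcq : coeffQuotient q dv dc ω n ≠ 0 := fun h0 => hn (by rw [heq, h0, zero_div])
  refine ⟨⟨hlen, hcq⟩, ?_⟩
  rw [← logb_prod_card_leeIndex hq hsum hlen, ← Real.logb_div hcq, heq]
  intro h0
  exact hn (by rw [heq, h0, div_zero])

theorem tendsto_logb_checkProb (hq : 2 ≤ q) (hdv : 0 < dv) (hdc : 0 < dc)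
    (hω : ∀ i, 0 < ω i) (hsum : ∑ i, ω i = 1)
    (hint : ∃ n : ℕ, 0 < n ∧ ∀ i, ∃ k : ℕ, ω i * n * dv = k)
    (ht : IsSaddlePoint q dc ω t) :
    Tendsto (fun n : ℕ => 1 / (n : ℝ) * Real.logb 2 (checkProb q dv dc ω n))
      (atTop ⊓ 𝓟 {n | checkProb q dv dc ω n ≠ 0})
      (𝓝 (dv * (-entropy ω - twoFraction q ω + Real.logb 2 (genFunRoot q dc t)
          - ∑ i : Fin (q / 2), ω i.succ * Real.logb 2 (t i)))) := by
  have hsub : {n | checkProb q dv dc ω n ≠ 0} ⊆ coeffLengths q dv dc ω := fun n hn =>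
    (logb_checkProb hq hdv hω hsum hn).1
  have h := ((tendsto_logb_coeffQuotient hq hdv hdc hω hsum hint ht).mono_left
    (inf_le_inf_left _ (principal_mono.2 hsub))).sub_const (dv * twoFraction q ω)
  convert h.congr' ?_ using 2
  · ring
  · filter_upwards [eventually_inf_principal.2 (Eventually.of_forall fun _ hn => hn),
      inf_le_left (a := (atTop : Filter ℕ)) (eventually_gt_atTop 0)] with n hn hn0
    have hn0' : (0 : ℝ) < n := by exact_mod_cast hn0
    rw [(logb_checkProb hq hdv hω hsum hn).2]
    field_simp

/-- At all large multiples of the length `2 n₀ dv dc` the coefficient is nonzero by the lower bound,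
and some word has Lee type `ω`; the factor `dv` makes `n ω`, not only `n dv ω`, integral. -/
theorem infinite_checkProb_ne_zero (hq : 2 ≤ q) (hdv : 0 < dv) (hdc : 0 < dc)
    (hω : ∀ i, 0 < ω i) (hsum : ∑ i, ω i = 1)
    (hint : ∃ n : ℕ, 0 < n ∧ ∀ i, ∃ k : ℕ, ω i * n * dv = k)
    (ht : IsSaddlePoint q dc ω t) :
    {n | checkProb q dv dc ω n ≠ 0}.Infinite := by
  choose e he using exists_checkExponent_eq_single (q := q) (ht.two_le hq hdc hω)
  obtain ⟨n₀, hn₀, hint⟩ := hint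
  have hev := (ht.isGibbsMean hdc).eventually_scaledCoeff_ne_zero ht.1
    (checkExponent_zero (q := q) (dc := dc)) he (Nat.mul_pos hn₀ hdv)
    (exists_nat_mean_mul hint)
  have hev' := ((tendsto_id.atTop_mul_const' hdv).eventually hev).and (eventually_gt_atTop 0)
  obtain ⟨j₀, hj₀⟩ := eventually_atTop.1 hev'
  have hM : 0 < n₀ * dv * dc * 2 := by positivity
  refine Set.infinite_of_injective_forall_mem (f := fun j => n₀ * dv * dc * 2 * (j + j₀))
    (fun a b hab => by simpa [hM.ne', hn₀.ne', hdv.ne', hdc.ne'] using hab) fun j => ?_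
  obtain ⟨hsc, hj⟩ := hj₀ (j + j₀) (Nat.le_add_left _ _)
  set i₁ := j + j₀
  set n := n₀ * dv * dc * 2 * i₁ with hn
  have hndv : n * dv = dc * (2 * (n₀ * dv) * (i₁ * dv)) := by
    rw [hn]
    ring
  have hn0 : 0 < n := by positivity
  have hint' : ∀ i, ∃ k : ℕ, ω i * n = k := by
    intro i
    obtain ⟨k, hk⟩ := hint i
    refine ⟨k * dc * 2 * i₁, ?_⟩
    rw [hn]
    push_cast
    rw [← hk]
    ring
  have hlen : IsLength q dv dc ω n := by
    refine ⟨Dvd.intro _ hndv.symm, fun i => ?_⟩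
    obtain ⟨k, hk⟩ := hint' i
    exact ⟨k * dv, by rw [hk]; push_cast; rfl⟩
  obtain ⟨x, hx⟩ := exists_outcome hdv hsum hlen hn0 hint'
  have hdiv : n * dv / dc = 2 * (n₀ * dv) * (i₁ * dv) := by
    rw [hndv, Nat.mul_div_cancel_left _ hdc]
  change checkProb q dv dc ω n ≠ 0
  rw [checkProb_eq hdv hsum hlen hn0 x hx, coeffQuotient_eq hdc hlen, hdiv]
  refine div_ne_zero (div_ne_zero hsc ?_) (Finset.prod_ne_zero_iff.2 fun i _ => pow_ne_zero _ ?_)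
  · exact Nat.cast_ne_zero.2 (Nat.multinomial_pos _ _).ne'
  · rw [card_leeIndex_eq]
    split_ifs <;> norm_num

end Lengths

end LeeLDPC

theorem mainTheorem10 (q dv dc : ℕ) [NeZero q] (hdv : 0 < dv) (hdc : 0 < dc)
    (ω : Fin (q / 2 + 1) → ℝ) (hω : ∀ i, ω i ∈ Set.Ioo (0 : ℝ) 1) (hsum : ∑ i, ω i = 1)
    (hint : ∃ n : ℕ, 0 < n ∧ ∀ i, ∃ k : ℕ, ω i * n * dv = k)
    (t : Fin (q / 2) → ℝ) (ht : LeeLDPC.IsSaddlePoint q dc ω t) :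
    (∀ s, LeeLDPC.IsSaddlePoint q dc ω s → s = t) ∧
    ({n : ℕ | LeeLDPC.IsLength q dv dc ω n ∧ LeeLDPC.coeffQuotient q dv dc ω n ≠ 0}.Infinite ∧
      Tendsto (fun n : ℕ => 1 / (n : ℝ) * Real.logb 2 (LeeLDPC.coeffQuotient q dv dc ω n))
        (atTop ⊓ 𝓟 {n : ℕ | LeeLDPC.IsLength q dv dc ω n ∧
          LeeLDPC.coeffQuotient q dv dc ω n ≠ 0})
        (𝓝 (dv * (-LeeLDPC.entropy ω + Real.logb 2 (LeeLDPC.genFunRoot q dc t)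
          - ∑ i : Fin (q / 2), ω i.succ * Real.logb 2 (t i))))) ∧
    ({n : ℕ | LeeLDPC.checkProb q dv dc ω n ≠ 0}.Infinite ∧
      Tendsto (fun n : ℕ => 1 / (n : ℝ) * Real.logb 2 (LeeLDPC.checkProb q dv dc ω n))
        (atTop ⊓ 𝓟 {n : ℕ | LeeLDPC.checkProb q dv dc ω n ≠ 0})
        (𝓝 (dv * (-LeeLDPC.entropy ω - LeeLDPC.twoFraction q ω
          + Real.logb 2 (LeeLDPC.genFunRoot q dc t)
          - ∑ i : Fin (q / 2), ω i.succ * Real.logb 2 (t i))))) := by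
  have hq : 2 ≤ q := by
    by_contra hlt
    obtain rfl : q = 1 := by
      have := NeZero.pos q
      omega
    have h0 := (hω 0).2
    rw [Fin.sum_univ_succ, Finset.sum_eq_zero fun i _ => Fin.elim0 i, add_zero] at hsum
    exact h0.ne hsum
  have hpos : ∀ i, 0 < ω i := fun i => (hω i).1
  have hinf := LeeLDPC.infinite_checkProb_ne_zero hq hdv hdc hpos hsum hint ht
  refine ⟨fun s hs => ?_, ⟨hinf.mono fun n hn => (LeeLDPC.logb_checkProb hq hdv hpos hsum hn).1,
    LeeLDPC.tendsto_logb_coeffQuotient hq hdv hdc hpos hsum hint ht⟩, hinf,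
    LeeLDPC.tendsto_logb_checkProb hq hdv hdc hpos hsum hint ht⟩
  choose e he using LeeLDPC.exists_checkExponent_eq_single (q := q) (ht.two_le hq hdc hpos)
  exact (hs.isGibbsMean hdc).eq (ht.isGibbsMean hdc) hs.1 ht.1
    (LeeLDPC.checkExponent_zero (q := q) (dc := dc)) he
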